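/- Let $-\infty\le a<b\le\infty$ and let $n$ be a non-negative integer. Let $J\in\mathbb C^{n\times n}$ be constant, invertible and skew-Hermitian ($J^*=-J$). Let $q$ and $w$ be $n\times n$ matrices whose entries are distributions of order $0$ on $(a,b)$, i.e., distributional derivatives of functions of locally bounded variation, with $q$ Hermitian and $w$ non-negative. Assume that $a$ and $b$ are regular endpoints: the left-continuous anti-derivatives of $q$ and $w$ are of bounded variation on $(a,c)$ and on $(c',b)$ for some $c,c'\in(a,b)$ (so that $q$ and $w$ are finite matrix-valued measures on $(a,b)$). Let $\lambda\in\mathbb C$, and let $f:(a,b)\to\mathbb C^n$ be a measurable function with $\int_{(a,b)} f^*wf<\infty$. A solution of $Ju'+(q-\lambda w)u=wf$ means a function $u:(a,b)\to\mathbb C^n$ of locally bounded variation which is balanced, i.e., $u(x)=\tfrac12(u^+(x)+u^-(x))$ for all $x\in(a,b)$, where $u^\pm$ are the right- and left-hand limits, and for which the two sides of the equation agree as distributions of order $0$ (locally, as $\mathbb C^n$-valued measures) on $(a,b)$. It is said to vanish at $a$ and $b$ if $\lim_{x\downarrow a}u(x)=0$ and $\lim_{x\uparrow b}u(x)=0$.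 **Theorem.** The equation $Ju'+(q-\lambda w)u=wf$ has a solution on $(a,b)$ which vanishes at $a$ and at $b$ if and only if $\int_{(a,b)} v^*wf=0$ for every solution $v$ of $Jv'+(q-\overline\lambda w)v=0$ on $(a,b)$. -/

import Mathlib

open Set Filter Topology MeasureTheory
open scoped Matrix ComplexOrder

noncomputable section

namespace MeasureODE

/-- The real interval `(a, b)`, whose endpoints may be infinite. -/
def interval (a b : EReal) : Set ℝ := {x : ℝ | a < (x : EReal) ∧ (x : EReal) < b}

instance interval_ordConnected (a b : EReal) : OrdConnected (interval a b) :=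
  ⟨fun _ hx _ hy _ hz =>
    ⟨hx.1.trans_le (EReal.coe_le_coe_iff.2 hz.1), (EReal.coe_le_coe_iff.2 hz.2).trans_lt hy.2⟩⟩

theorem isOpen_interval (a b : EReal) : IsOpen (interval a b) :=
  (isOpen_Ioi.preimage continuous_coe_real_ereal).inter
    (isOpen_Iio.preimage continuous_coe_real_ereal)

instance interval_compactIccSpace (a b : EReal) : CompactIccSpace (interval a b) := by
  refine ⟨fun {x y} => ?_⟩
  rw [Subtype.isCompact_iff]
  have h : ((↑) : interval a b → ℝ) '' Icc x y = Icc (x : ℝ) (y : ℝ) := by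
    ext z
    constructor
    · rintro ⟨z, hz, rfl⟩
      exact hz
    · intro hz
      exact ⟨⟨z, (interval_ordConnected a b).out x.2 y.2 hz⟩, hz, rfl⟩
  rw [h]
  exact isCompact_Icc

/-- An `n × n` matrix of distributions of order `0` on `(a, b)`. Such distributions are the
distributional derivatives of functions of locally bounded variation; the matrix is given by its
left-continuous anti-derivative `prim` (which is unique up to an additive constant; the values of
`prim` outside `(a, b)` play no role). -/
structure OrderZeroMatrix (a b : EReal) (n : ℕ) where
  prim : ℝ → Matrix (Fin n) (Fin n) ℂ
  locallyBV : ∀ i j, LocallyBoundedVariationOn (fun x => prim x i j) (interval a b)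
  leftCont : ∀ i j, ∀ x ∈ interval a b, ContinuousWithinAt (fun y => prim y i j) (Iio x) x

namespace OrderZeroMatrix

variable {a b : EReal} {n : ℕ}

/-- The distribution is Hermitian: it assigns a Hermitian matrix to each `[s, t) ⊆ (a, b)`. -/
def IsHermitian (q : OrderZeroMatrix a b n) : Prop :=
  ∀ s ∈ interval a b, ∀ t ∈ interval a b, s ≤ t → (q.prim t - q.prim s).IsHermitian

/-- The distribution is non-negative: it assigns a positive semi-definite matrix to each
`[s, t) ⊆ (a, b)`. -/
def IsNonneg (q : OrderZeroMatrix a b n) : Prop :=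
  ∀ s ∈ interval a b, ∀ t ∈ interval a b, s ≤ t → (q.prim t - q.prim s).PosSemidef

/-- `a` is a regular endpoint for `q`: the left-continuous anti-derivative is of bounded variation
on `(a, c)` for some `c ∈ (a, b)`. -/
def RegularLeft (q : OrderZeroMatrix a b n) : Prop :=
  ∃ c ∈ interval a b, ∀ i j, BoundedVariationOn (fun x => q.prim x i j) (interval a (c : EReal))

/-- `b` is a regular endpoint for `q`: the left-continuous anti-derivative is of bounded variation
on `(c, b)` for some `c ∈ (a, b)`. -/
def RegularRight (q : OrderZeroMatrix a b n) : Prop :=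
  ∃ c ∈ interval a b, ∀ i j, BoundedVariationOn (fun x => q.prim x i j) (interval (c : EReal) b)

/-- Both endpoints are regular for `q`. -/
def Regular (q : OrderZeroMatrix a b n) : Prop := q.RegularLeft ∧ q.RegularRight

theorem Regular.boundedVariationOn {q : OrderZeroMatrix a b n} (hq : q.Regular) (i j : Fin n) :
    BoundedVariationOn (fun x => q.prim x i j) (interval a b) := by
  obtain ⟨⟨c, hc, hcv⟩, ⟨d, hd, hdv⟩⟩ := hq
  obtain ⟨c', hac', hcc'⟩ := EReal.lt_iff_exists_real_btwn.1 hc.1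
  obtain ⟨d', hdd', hdb'⟩ := EReal.lt_iff_exists_real_btwn.1 hd.2
  have hc'I : c' ∈ interval a b := ⟨hac', hcc'.trans hc.2⟩
  have hd'I : d' ∈ interval a b := ⟨hd.1.trans hdd', hdb'⟩
  have h1 : eVariationOn (fun x => q.prim x i j) (interval a b ∩ Iic c') ≠ ⊤ :=
    (hcv i j).mono fun x hx => ⟨hx.1.1, (EReal.coe_le_coe_iff.2 hx.2).trans_lt hcc'⟩
  have h2 : eVariationOn (fun x => q.prim x i j) (interval a b ∩ Ici c' ∩ Iic (max c' d')) ≠ ⊤ :=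
    ((q.locallyBV i j) c' (max c' d') hc'I
      (by rcases max_choice c' d' with h | h <;> rw [h] <;> assumption)).mono
      fun x hx => ⟨hx.1.1, hx.1.2, hx.2⟩
  have h3 : eVariationOn (fun x => q.prim x i j) (interval a b ∩ Ici (max c' d')) ≠ ⊤ :=
    (hdv i j).mono fun x hx =>
      ⟨hdd'.trans_le (EReal.coe_le_coe_iff.2 ((le_max_right c' d').trans hx.2)), hx.1.2⟩
  have hmI : max c' d' ∈ interval a b := by
    rcases max_choice c' d' with h | h <;> rw [h] <;> assumption
  have e1 : interval a b = (interval a b ∩ Iic c') ∪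
      ((interval a b ∩ Ici c' ∩ Iic (max c' d')) ∪ (interval a b ∩ Ici (max c' d'))) := by
    ext x
    simp only [mem_union, mem_inter_iff, mem_Iic, mem_Ici]
    constructor
    · intro hx
      rcases le_total x c' with h | h
      · exact Or.inl ⟨hx, h⟩
      · rcases le_total x (max c' d') with h' | h'
        · exact Or.inr (Or.inl ⟨⟨hx, h⟩, h'⟩)
        · exact Or.inr (Or.inr ⟨hx, h'⟩)
    · rintro (h | h | h)
      exacts [h.1, h.1.1, h.1]
  rw [BoundedVariationOn, e1, eVariationOn.union (x := c'), eVariationOn.union (x := max c' d')]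
  · exact ENNReal.add_ne_top.2 ⟨h1, ENNReal.add_ne_top.2 ⟨h2, h3⟩⟩
  · exact ⟨⟨⟨hmI, le_max_left c' d'⟩, mem_Iic.2 le_rfl⟩, fun x hx => hx.2⟩
  · exact ⟨⟨hmI, mem_Ici.2 le_rfl⟩, fun x hx => hx.2⟩
  · exact ⟨⟨hc'I, mem_Iic.2 le_rfl⟩, fun x hx => hx.2⟩
  · refine ⟨Or.inl ⟨⟨hc'I, mem_Ici.2 le_rfl⟩, mem_Iic.2 (le_max_left c' d')⟩, fun x hx => ?_⟩
    rcases hx with hx | hx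
    · exact hx.1.2
    · exact (le_max_left _ _).trans hx.2

theorem Regular.boundedVariationOn_subtype {q : OrderZeroMatrix a b n} (hq : q.Regular)
    (i j : Fin n) : BoundedVariationOn (fun x : interval a b => q.prim x i j) univ :=
  ne_top_of_le_ne_top (hq.boundedVariationOn i j)
    (eVariationOn.comp_le_of_monotoneOn (fun x => q.prim x i j) ((↑) : interval a b → ℝ)
      (fun _ _ _ _ h => h) (fun x _ => x.2))

/-- When both endpoints are regular, the entry `q i j` is a complex measure on `(a, b)`, namely the
Stieltjes measure of its anti-derivative. It is viewed as a complex measure on `ℝ` which is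
concentrated on `(a, b)`. -/
def entry (q : OrderZeroMatrix a b n) (hq : q.Regular) (i j : Fin n) : ComplexMeasure ℝ :=
  (hq.boundedVariationOn_subtype i j).vectorMeasure.map ((↑) : interval a b → ℝ)

/-- The measure `q i j` has mass `prim t i j - prim s i j` on `[s, t)`. -/
theorem entry_Ico (q : OrderZeroMatrix a b n) (hq : q.Regular) (i j : Fin n) {s t : ℝ}
    (hs : s ∈ interval a b) (ht : t ∈ interval a b) (hst : s ≤ t) :
    q.entry hq i j (Ico s t) = q.prim t i j - q.prim s i j := by
  have hlim : ∀ x : interval a b,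
      Function.leftLim (fun y : interval a b => q.prim y i j) x = q.prim x i j := by
    intro x
    obtain ⟨r, hr, hrx⟩ := EReal.lt_iff_exists_real_btwn.1 x.2.1
    have hrI : r ∈ interval a b := ⟨hr, hrx.trans x.2.2⟩
    have hne : (𝓝[<] x).NeBot := by
      rw [← mem_closure_iff_nhdsWithin_neBot,
        closure_Iio' ⟨(⟨r, hrI⟩ : interval a b), EReal.coe_lt_coe_iff.1 hrx⟩]
      exact mem_Iic.2 le_rfl
    refine leftLim_eq_of_tendsto ?_
    refine (q.leftCont i j x x.2).tendsto.comp ?_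
    exact tendsto_nhdsWithin_of_tendsto_nhds_of_eventually_within _
      (continuous_subtype_val.continuousAt.mono_left nhdsWithin_le_nhds)
      (eventually_nhdsWithin_of_forall fun y hy => hy)
  have hpre : ((↑) : interval a b → ℝ) ⁻¹' Ico s t = Ico ⟨s, hs⟩ ⟨t, ht⟩ := rfl
  rw [entry, VectorMeasure.map_apply _ measurable_subtype_coe measurableSet_Ico, hpre,
    BoundedVariationOn.vectorMeasure_Ico _ (show (⟨s, hs⟩ : interval a b) ≤ ⟨t, ht⟩ from hst),
    hlim, hlim]

/-- A finite positive measure with respect to which all entries of `q` are absolutely continuous: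
the sum of the total variations of the real and imaginary parts of the entries. -/
def base (q : OrderZeroMatrix a b n) (hq : q.Regular) : Measure ℝ :=
  ∑ i, ∑ j, ((ComplexMeasure.re (q.entry hq i j)).totalVariation +
    (ComplexMeasure.im (q.entry hq i j)).totalVariation)

/-- The Radon-Nikodym derivative of the matrix-valued measure `q` with respect to `q.base`. For a
vector function `g`, the product `q g` is the `ℂⁿ`-valued measure with density
`q.density * g` with respect to `q.base`. -/
def density (q : OrderZeroMatrix a b n) (hq : q.Regular) (x : ℝ) : Matrix (Fin n) (Fin n) ℂ :=
  Matrix.of fun i j => (q.entry hq i j).rnDeriv (q.base hq) x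

instance base_isFiniteMeasure (q : OrderZeroMatrix a b n) (hq : q.Regular) :
    IsFiniteMeasure (q.base hq) := by
  refine ⟨?_⟩
  simp only [base, Measure.finsetSum_apply, Measure.add_apply]
  exact ENNReal.sum_lt_top.2 fun i _ => ENNReal.sum_lt_top.2 fun j _ =>
    ENNReal.add_lt_top.2 ⟨measure_lt_top _ _, measure_lt_top _ _⟩

/-- The entries of `q.density` are the densities of the entries of `q`. -/
theorem withDensity_density (q : OrderZeroMatrix a b n) (hq : q.Regular) (i j : Fin n) :
    (q.base hq).withDensityᵥ (fun x => q.density hq x i j) = q.entry hq i j := by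
  have hle : (ComplexMeasure.re (q.entry hq i j)).totalVariation +
      (ComplexMeasure.im (q.entry hq i j)).totalVariation ≤ q.base hq := by
    refine Measure.le_iff'.2 fun S => ?_
    simp only [base, Measure.finsetSum_apply, Measure.add_apply]
    refine le_trans ?_ (Finset.single_le_sum
      (f := fun i' => ∑ j', ((ComplexMeasure.re (q.entry hq i' j')).totalVariation S +
        (ComplexMeasure.im (q.entry hq i' j')).totalVariation S))
      (fun _ _ => zero_le) (Finset.mem_univ i))
    exact Finset.single_le_sum
      (f := fun j' => (ComplexMeasure.re (q.entry hq i j')).totalVariation S +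
        (ComplexMeasure.im (q.entry hq i j')).totalVariation S)
      (fun _ _ => zero_le) (Finset.mem_univ j)
  have hre : (ComplexMeasure.re (q.entry hq i j)).totalVariation ≪ q.base hq :=
    ((Measure.le_add_right le_rfl).trans hle).absolutelyContinuous
  have him : (ComplexMeasure.im (q.entry hq i j)).totalVariation ≪ q.base hq :=
    ((Measure.le_add_left le_rfl).trans hle).absolutelyContinuous
  have key : ∀ s : SignedMeasure ℝ, s.totalVariation ≪ q.base hq →
      (q.base hq).withDensityᵥ (s.rnDeriv (q.base hq)) = s := fun s hs =>
    s.withDensityᵥ_rnDeriv_eq _ ((s.absolutelyContinuous_ennreal_iff _).2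
      (by rwa [VectorMeasure.ennrealToMeasure_toENNRealVectorMeasure]))
  have hd : (fun x => q.density hq x i j) = (q.entry hq i j).rnDeriv (q.base hq) := rfl
  have hint := (q.entry hq i j).integrable_rnDeriv (q.base hq)
  rw [hd]
  ext S hS
  rw [withDensityᵥ_apply hint hS]
  apply Complex.ext
  · rw [← RCLike.re_eq_complex_re, ← integral_re hint.integrableOn]
    have := congrArg (fun m => m S) (key _ hre)
    rw [withDensityᵥ_apply (SignedMeasure.integrable_rnDeriv _ _) hS] at this
    exact this
  · rw [← RCLike.im_eq_complex_im, ← integral_im hint.integrableOn]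
    have := congrArg (fun m => m S) (key _ him)
    rw [withDensityᵥ_apply (SignedMeasure.integrable_rnDeriv _ _) hS] at this
    exact this

/-- The density integrates to `prim t i j - prim s i j` over `[s, t)`. -/
theorem density_Ico (q : OrderZeroMatrix a b n) (hq : q.Regular) (i j : Fin n) {s t : ℝ}
    (hs : s ∈ interval a b) (ht : t ∈ interval a b) (hst : s ≤ t) :
    ∫ x in Ico s t, q.density hq x i j ∂(q.base hq) = q.prim t i j - q.prim s i j := by
  have hint : Integrable (fun x => q.density hq x i j) (q.base hq) :=
    (q.entry hq i j).integrable_rnDeriv (q.base hq)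
  rw [← q.entry_Ico hq i j hs ht hst, ← q.withDensity_density hq i j]
  exact (withDensityᵥ_apply hint measurableSet_Ico).symm

/-- The vector `(q g)([s, t)) = ∫_{[s, t)} q g`. -/
def intervalProd (q : OrderZeroMatrix a b n) (hq : q.Regular) (g : ℝ → Fin n → ℂ) (s t : ℝ) :
    Fin n → ℂ :=
  ∫ x in Ico s t, q.density hq x *ᵥ g x ∂(q.base hq)

/-- The number `∫ g^* q h`, the integral being extended over `(a, b)`. -/
def pairing (q : OrderZeroMatrix a b n) (hq : q.Regular) (g h : ℝ → Fin n → ℂ) : ℂ :=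
  ∫ x in interval a b, star (g x) ⬝ᵥ (q.density hq x *ᵥ h x) ∂(q.base hq)

/-- `f` belongs to `𝓛²(w)`: it is measurable and `∫ f^* w f < ∞`. -/
def MemL2 (w : OrderZeroMatrix a b n) (hw : w.Regular) (f : ℝ → Fin n → ℂ) : Prop :=
  AEStronglyMeasurable f ((w.base hw).restrict (interval a b)) ∧
    IntegrableOn (fun x => star (f x) ⬝ᵥ (w.density hw x *ᵥ f x)) (interval a b) (w.base hw)

end OrderZeroMatrix

/-- `u` is a balanced function of locally bounded variation on `(a, b)`: at each point its value is
the average of its one-sided limits. -/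
def IsBalancedBV (a b : EReal) {n : ℕ} (u : ℝ → Fin n → ℂ) : Prop :=
  LocallyBoundedVariationOn u (interval a b) ∧
    ∀ x ∈ interval a b, u x = (2⁻¹ : ℂ) • (Function.leftLim u x + Function.rightLim u x)

/-- `u` is a balanced solution of locally bounded variation of `J u' + (q - lam w) u = w f` on
`(a, b)`. Both sides are `ℂⁿ`-valued measures on each compact subinterval of `(a, b)`, and they are
equal if and only if they agree on all `[s, t)` with `s, t ∈ (a, b)`; the measure `u'` has mass
`u⁻(t) - u⁻(s)` there. -/
def IsSolution {a b : EReal} {n : ℕ} (J : Matrix (Fin n) (Fin n) ℂ) (q w : OrderZeroMatrix a b n)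
    (hq : q.Regular) (hw : w.Regular) (lam : ℂ) (f u : ℝ → Fin n → ℂ) : Prop :=
  IsBalancedBV a b u ∧
    ∀ s ∈ interval a b, ∀ t ∈ interval a b, s ≤ t →
      J *ᵥ (Function.leftLim u t - Function.leftLim u s) +
          (q.intervalProd hq u s t - lam • w.intervalProd hw u s t) =
        w.intervalProd hw f s t

/-- `u` vanishes at `a`, that is, `u⁺(a) = 0`: `u x → 0` as the real `x` decreases to `a`. -/
def VanishesAtLeft (a : EReal) {n : ℕ} (u : ℝ → Fin n → ℂ) : Prop :=
  Tendsto u (comap ((↑) : ℝ → EReal) (𝓝[>] a)) (𝓝 0)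

/-- `u` vanishes at `b`, that is, `u⁻(b) = 0`: `u x → 0` as the real `x` increases to `b`. -/
def VanishesAtRight (b : EReal) {n : ℕ} (u : ℝ → Fin n → ℂ) : Prop :=
  Tendsto u (comap ((↑) : ℝ → EReal) (𝓝[<] b)) (𝓝 0)

end MeasureODE

end

/-! Fix one finite measure `μ` on `(a, b)` dominating both `q` and `w`, with bounded matrix
densities `Q` and `W`. Let `K g` be the balanced primitive, the integral of `g` over `(-∞, x)` plus
half the atom at `x`. Solutions are exactly the functions `u = c + K g` on `(a, b)` with `g ∈ L²(μ)`
and `J g + A (c + K g) = W f` a.e., where `A = Q - lam W`. The limit of `u` at `a` is `c` and at `b`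
it is `c + ∫ g`. The boundary value problem thus asks whether `W f` lies in the image of `N = {∫ g =
0}` under `T = J + A K`.

This is a Fredholm alternative. The operator `K` is compact on `L²(μ)` and `J` is invertible, so `T
N` is closed (`isClosed_map_add_compact`) and equals its double orthogonal complement. Integration
by parts (`integral_inner_balancedPrim_add`), where the value 1/2 on the diagonal accounts for
atoms, identifies the orthogonal complement as the functions `c + K h` with `J h + A* (c + K h) = 0`
(`exists_ae_eq_of_orthogonal`). Since `Q` and `W` are Hermitian a.e., these are the solutions of the
homogeneous equation for the conjugate parameter.

Two estimates make `L²(μ)` the right space: positivity of `W` gives `‖W f‖² ≤ 2 f* W f`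
(`memLp_densityWrt_mulVec`), and a Gronwall argument shows that solutions, a priori only locally
bounded, are bounded up to the regular endpoints (`exists_norm_le_of_gronwall`). -/

namespace MeasureODE

/-! ### Closed range for invertible plus compact operators -/

section ClosedRange

variable {H : Type*} [NormedAddCommGroup H] [InnerProductSpace ℂ H]

/-- A left-invertible operator plus a sequentially compact one is bounded below on every closed
subspace which it maps injectively. -/
theorem exists_norm_le_of_injOn (J Ji S : H →L[ℂ] H) (hJ : ∀ x, Ji (J x) = x)
    (hS : ∀ g : ℕ → H, (∀ n, ‖g n‖ ≤ 1) →
      ∃ φ : ℕ → ℕ, StrictMono φ ∧ ∃ k, Tendsto (fun n => S (g (φ n))) atTop (𝓝 k))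
    (N : Submodule ℂ H) (hN : IsClosed (N : Set H))
    (hinj : ∀ x ∈ N, (J + S) x = 0 → x = 0) :
    ∃ C : ℝ, ∀ x ∈ N, ‖x‖ ≤ C * ‖(J + S) x‖ := by
  by_contra! hcon
  have hex : ∀ n : ℕ, ∃ x ∈ N, ‖x‖ = 1 ∧ ‖(J + S) x‖ < 1 / (n + 1 : ℝ) := by
    intro n
    obtain ⟨x, hxN, hx⟩ := hcon (n + 1)
    have hx0 : 0 < ‖x‖ := lt_of_le_of_lt (by positivity) hx
    refine ⟨((‖x‖⁻¹ : ℝ) : ℂ) • x, N.smul_mem _ hxN, ?_, ?_⟩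
    · rw [norm_smul, Complex.norm_real, norm_inv, norm_norm, inv_mul_cancel₀ hx0.ne']
    · rw [map_smul, norm_smul, Complex.norm_real, norm_inv, norm_norm, lt_div_iff₀ (by positivity),
        mul_assoc, inv_mul_lt_iff₀ hx0, mul_one, mul_comm]
      exact hx
  choose g hgN hg1 hgT using hex
  obtain ⟨φ, hφ, k, hk⟩ := hS g fun n => (hg1 n).le
  have hT0 : Tendsto (fun n => (J + S) (g (φ n))) atTop (𝓝 0) := by
    refine squeeze_zero_norm (fun n => (hgT (φ n)).le) ?_
    exact tendsto_one_div_add_atTop_nhds_zero_nat.comp hφ.tendsto_atTop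
  -- Since `g = Ji (T g - S g)` with `T = J + S`, convergence of `T g` and `S g` forces norm
  -- convergence of `g`. The limit is a unit vector of `N` killed by `T`.
  have hglim : Tendsto (fun n => g (φ n)) atTop (𝓝 (Ji (0 - k))) := by
    refine ((Ji.continuous.tendsto _).comp (hT0.sub hk)).congr fun n => ?_
    simp [hJ]
  have hmem := hN.mem_of_tendsto hglim (Eventually.of_forall fun n => hgN _)
  have hnorm := tendsto_nhds_unique hglim.norm
    (tendsto_const_nhds.congr fun n => (hg1 (φ n)).symm)
  have hzero := tendsto_nhds_unique (((J + S).continuous.tendsto _).comp hglim) hT0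
  rw [hinj _ hmem hzero, norm_zero] at hnorm
  exact zero_ne_one hnorm

/-- The image of a closed subspace under a left-invertible operator plus a sequentially compact one
is closed. -/
theorem isClosed_map_add_compact [CompleteSpace H] (J Ji S : H →L[ℂ] H) (hJ : ∀ x, Ji (J x) = x)
    (hS : ∀ g : ℕ → H, (∀ n, ‖g n‖ ≤ 1) →
      ∃ φ : ℕ → ℕ, StrictMono φ ∧ ∃ k, Tendsto (fun n => S (g (φ n))) atTop (𝓝 k))
    (N : Submodule ℂ H) (hN : IsClosed (N : Set H)) :
    IsClosed ((N.map (J + S).toLinearMap : Submodule ℂ H) : Set H) := by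
  set T := J + S with hT
  set Z : Submodule ℂ H := T.ker ⊓ N with hZ
  have hZc : IsClosed (Z : Set H) := T.isClosed_ker.inter hN
  have : CompleteSpace Z := hZc.completeSpace_coe
  -- Removing the kernel makes `T` injective on `N'` and does not change the image of `N`, so `T` is
  -- bounded below on `N'` and its image is complete.
  set N' : Submodule ℂ H := N ⊓ Zᗮ with hN'
  have hN'c : IsClosed (N' : Set H) := hN.inter Z.isClosed_orthogonal
  obtain ⟨C, hC⟩ := exists_norm_le_of_injOn J Ji S hJ hS N' hN'c (by
    intro x hx hx0
    have hxZ : x ∈ Z := ⟨hx0, hx.1⟩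
    exact inner_self_eq_zero.1 (hx.2 x hxZ))
  have hmap : N.map T.toLinearMap = N'.map T.toLinearMap := by
    apply le_antisymm
    · rintro _ ⟨x, hx, rfl⟩
      have hp : Z.starProjection x ∈ Z := Z.starProjection_apply_mem x
      refine ⟨x - Z.starProjection x, ⟨N.sub_mem hx hp.2, Z.sub_starProjection_mem_orthogonal x⟩, ?_⟩
      have h0 : T (Z.starProjection x) = 0 := hp.1
      simp [h0]
    · exact Submodule.map_mono inf_le_left
  rw [hmap]
  have : CompleteSpace N' := hN'c.completeSpace_coe
  have hanti : AntilipschitzWith C.toNNReal (T.comp N'.subtypeL) := by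
    refine AddMonoidHomClass.antilipschitz_of_bound _ fun x => ?_
    refine (hC x x.2).trans ?_
    exact mul_le_mul_of_nonneg_right (Real.le_coe_toNNReal C) (norm_nonneg _)
  have := hanti.isClosed_range (T.comp N'.subtypeL).uniformContinuous
  convert this using 1
  ext y
  simp [hT]

end ClosedRange

/-! ### Weak sequential compactness -/

section WeakCompactness

variable {H : Type*} [NormedAddCommGroup H] [InnerProductSpace ℂ H] [CompleteSpace H]
  [TopologicalSpace.SeparableSpace H]

/-- Every bounded sequence in a separable Hilbert space has a weakly convergent subsequence. -/
theorem exists_subseq_tendsto_inner (g : ℕ → H) (hg : ∀ n, ‖g n‖ ≤ 1) :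
    ∃ φ : ℕ → ℕ, StrictMono φ ∧ ∃ x : H, ∀ y : H,
      Tendsto (fun n => inner ℂ (g (φ n)) y) atTop (𝓝 (inner ℂ x y)) := by
  -- Sequential Banach–Alaoglu in the dual, which the Riesz map identifies with `H`.
  obtain ⟨l, -, φ, hφ, hl⟩ := WeakDual.isSeqCompact_closedBall ℂ H 0 1
    (x := fun n => StrongDual.toWeakDual (InnerProductSpace.toDual ℂ H (g n))) (fun n => by
      simpa using hg n)
  refine ⟨φ, hφ, (InnerProductSpace.toDual ℂ H).symm (WeakDual.toStrongDual l), fun y => ?_⟩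
  rw [InnerProductSpace.toDual_symm_apply]
  have := ((WeakDual.eval_continuous y).tendsto l).comp hl
  exact this

end WeakCompactness

/-! ### Balanced primitives -/

/-- The kernel of the balanced primitive. -/
noncomputable def stepKernel (x y : ℝ) : ℝ := if y < x then 1 else if y = x then 1 / 2 else 0

/-- The value 1/2 on the diagonal makes this hold at `x = y` too, so integration by parts has no
correction term at common atoms. -/
theorem stepKernel_add_swap (x y : ℝ) : stepKernel x y + stepKernel y x = 1 := by
  unfold stepKernel
  rcases lt_trichotomy x y with h | h | h
  · simp [h, h.not_gt, h.ne']
  · simp only [h, lt_irrefl, if_true, if_false]; norm_num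
  · simp [h, h.not_gt, h.ne']

theorem stepKernel_nonneg (x y : ℝ) : 0 ≤ stepKernel x y := by
  unfold stepKernel; split_ifs <;> norm_num

theorem stepKernel_le_one (x y : ℝ) : stepKernel x y ≤ 1 := by
  have := stepKernel_add_swap x y
  have := stepKernel_nonneg y x
  linarith

theorem stepKernel_mono (y : ℝ) : Monotone fun x => stepKernel x y := by
  intro x x' h
  simp only [stepKernel]
  split_ifs <;> first | (norm_num; done) | grind

theorem measurable_stepKernel : Measurable fun p : ℝ × ℝ => stepKernel p.1 p.2 := by
  unfold stepKernel
  refine Measurable.ite (measurableSet_lt measurable_snd measurable_fst) measurable_const ?_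
  exact Measurable.ite (measurableSet_eq_fun measurable_snd measurable_fst) measurable_const
    measurable_const

theorem measurable_stepKernel_left (x : ℝ) : Measurable (stepKernel x) :=
  measurable_stepKernel.comp (measurable_const.prodMk measurable_id)

section Prim

variable {E : Type*} [NormedAddCommGroup E] [NormedSpace ℝ E] {μ : Measure ℝ}

/-- The balanced primitive `x ↦ μ g (-∞, x) + μ g {x} / 2` of the vector measure `g μ`. -/
noncomputable def balancedPrim (μ : Measure ℝ) (g : ℝ → E) (x : ℝ) : E :=
  ∫ y, stepKernel x y • g y ∂μ

theorem norm_stepKernel_smul_le (x y : ℝ) (e : E) : ‖stepKernel x y • e‖ ≤ ‖e‖ := by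
  rw [norm_smul, Real.norm_of_nonneg (stepKernel_nonneg x y)]
  exact mul_le_of_le_one_left (norm_nonneg _) (stepKernel_le_one x y)

theorem integrable_stepKernel_smul {g : ℝ → E} (hg : Integrable g μ) (x : ℝ) :
    Integrable (fun y => stepKernel x y • g y) μ :=
  hg.mono ((measurable_stepKernel_left x).aestronglyMeasurable.smul hg.1)
    (Eventually.of_forall fun y => norm_stepKernel_smul_le x y (g y))

theorem norm_balancedPrim_le {g : ℝ → E} (hg : Integrable g μ) (x : ℝ) :
    ‖balancedPrim μ g x‖ ≤ ∫ y, ‖g y‖ ∂μ :=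
  norm_integral_le_of_norm_le hg.norm
    (Eventually.of_forall fun y => norm_stepKernel_smul_le x y (g y))

theorem aestronglyMeasurable_balancedPrim [SFinite μ] {g : ℝ → E} (hg : Integrable g μ) :
    AEStronglyMeasurable (balancedPrim μ g) μ :=
  AEStronglyMeasurable.integral_prod_right'
    (f := fun p : ℝ × ℝ => stepKernel p.1 p.2 • g p.2)
    (measurable_stepKernel.aestronglyMeasurable.smul hg.1.comp_snd)

theorem balancedPrim_congr {g h : ℝ → E} (hgh : g =ᵐ[μ] h) :
    balancedPrim μ g = balancedPrim μ h := by
  funext x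
  refine integral_congr_ae ?_
  filter_upwards [hgh] with y hy
  rw [hy]

theorem balancedPrim_comp {F : Type*} [NormedAddCommGroup F] [NormedSpace ℝ F] [CompleteSpace E]
    [CompleteSpace F] (L : E →L[ℝ] F) {g : ℝ → E} (hg : Integrable g μ) (x : ℝ) :
    balancedPrim μ (fun y => L (g y)) x = L (balancedPrim μ g x) := by
  rw [balancedPrim, balancedPrim, ← L.integral_comp_comm (integrable_stepKernel_smul hg x)]
  simp

end Prim

/-! ### Integration by parts -/

section Inner

variable {E : Type*} [NormedAddCommGroup E] [InnerProductSpace ℂ E] [FiniteDimensional ℂ E]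
  {μ : Measure ℝ} [IsFiniteMeasure μ]

/-- Integration by parts for balanced primitives. -/
theorem integral_inner_balancedPrim_add {g h : ℝ → E} (hg : Integrable g μ) (hh : Integrable h μ) :
    ∫ x, inner ℂ (balancedPrim μ h x) (g x) ∂μ + ∫ x, inner ℂ (h x) (balancedPrim μ g x) ∂μ =
      inner ℂ (∫ x, h x ∂μ) (∫ x, g x ∂μ) := by
  have : CompleteSpace E := FiniteDimensional.complete ℂ E
  have hint : Integrable (fun p : ℝ × ℝ => inner ℂ (h p.1) (g p.2)) (μ.prod μ) :=
    hh.op_fst_snd (op := fun x y => inner ℂ x y) continuous_inner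
      ⟨1, fun x y => by simpa using norm_inner_le_norm x y⟩ hg
  have hk : ∀ k : ℝ × ℝ → ℝ, Measurable k → (∀ p, 0 ≤ k p) → (∀ p, k p ≤ 1) →
      Integrable (fun p : ℝ × ℝ => (k p : ℂ) * inner ℂ (h p.1) (g p.2)) (μ.prod μ) := by
    intro k hk h0 h1
    refine hint.mono ((Complex.measurable_ofReal.comp hk).aestronglyMeasurable.mul hint.1)
      (Eventually.of_forall fun p => ?_)
    rw [norm_mul, Complex.norm_real, Real.norm_of_nonneg (h0 p)]
    exact mul_le_of_le_one_left (norm_nonneg _) (h1 p)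
  have hk1 := hk (fun p => stepKernel p.1 p.2) measurable_stepKernel
    (fun p => stepKernel_nonneg _ _) (fun p => stepKernel_le_one _ _)
  have hk2 := hk (fun p => stepKernel p.2 p.1) (measurable_stepKernel.comp measurable_swap)
    (fun p => stepKernel_nonneg _ _) (fun p => stepKernel_le_one _ _)
  -- By Fubini both terms become double integrals of `inner ℂ (h p.1) (g p.2)`, one against the
  -- kernel and one against its transpose. The two kernels add up to 1.
  have e1 : ∫ x, inner ℂ (balancedPrim μ h x) (g x) ∂μ =
      ∫ p, ((stepKernel p.2 p.1 : ℝ) : ℂ) * inner ℂ (h p.1) (g p.2) ∂(μ.prod μ) := by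
    rw [integral_prod_symm _ hk2]
    refine integral_congr_ae (Eventually.of_forall fun x => ?_)
    simp only
    rw [← inner_conj_symm, balancedPrim, ← integral_inner (integrable_stepKernel_smul hh x),
      ← integral_conj]
    refine integral_congr_ae (Eventually.of_forall fun y => ?_)
    simp only
    rw [inner_conj_symm, ← Complex.coe_smul, inner_smul_left, Complex.conj_ofReal]
  have e2 : ∫ x, inner ℂ (h x) (balancedPrim μ g x) ∂μ =
      ∫ p, ((stepKernel p.1 p.2 : ℝ) : ℂ) * inner ℂ (h p.1) (g p.2) ∂(μ.prod μ) := by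
    rw [integral_prod _ hk1]
    refine integral_congr_ae (Eventually.of_forall fun x => ?_)
    simp only
    rw [balancedPrim, ← integral_inner (integrable_stepKernel_smul hg x)]
    refine integral_congr_ae (Eventually.of_forall fun y => ?_)
    simp only
    rw [← Complex.coe_smul, inner_smul_right]
  rw [e1, e2, ← integral_add hk2 hk1]
  have e3 : inner ℂ (∫ x, h x ∂μ) (∫ x, g x ∂μ) =
      ∫ p : ℝ × ℝ, inner ℂ (h p.1) (g p.2) ∂(μ.prod μ) := by
    rw [integral_prod _ hint, ← inner_conj_symm, ← integral_inner hh, ← integral_conj]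
    refine integral_congr_ae (Eventually.of_forall fun x => ?_)
    simp only
    rw [inner_conj_symm, ← integral_inner hg]
  rw [e3]
  refine integral_congr_ae (Eventually.of_forall fun p => ?_)
  simp only
  rw [← add_mul, ← Complex.ofReal_add, stepKernel_add_swap, Complex.ofReal_one, one_mul]

end Inner

/-! ### Multiplication and primitive operators on `L²(μ)` -/

section Hilbert

variable {E : Type*} [NormedAddCommGroup E] {μ : Measure ℝ}

theorem integrable_of_memLp_two [IsFiniteMeasure μ] {f : ℝ → E} (hf : MemLp f 2 μ) :
    Integrable f μ :=
  hf.integrable (by norm_num)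

/-- Cauchy–Schwarz against the constant 1; the exponent of the total mass is 1/2. -/
theorem integral_norm_le_mul_norm [IsFiniteMeasure μ] (g : Lp E 2 μ) :
    ∫ x, ‖g x‖ ∂μ ≤ (μ univ ^ (1 / (1 : ENNReal).toReal - 1 / (2 : ENNReal).toReal)).toReal * ‖g‖ := by
  rw [integral_norm_eq_lintegral_enorm (Lp.aestronglyMeasurable g), ← eLpNorm_one_eq_lintegral_enorm,
    mul_comm, Lp.norm_def, ← ENNReal.toReal_mul]
  refine ENNReal.toReal_mono ?_
    (eLpNorm_le_eLpNorm_mul_rpow_measure_univ (by norm_num) (Lp.aestronglyMeasurable g))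
  refine ENNReal.mul_ne_top (Lp.eLpNorm_ne_top g) (ENNReal.rpow_ne_top_of_nonneg ?_ (by finiteness))
  norm_num

variable [InnerProductSpace ℂ E]

theorem integrable_inner_of_memLp {f g : ℝ → E} (hf : MemLp f 2 μ) (hg : MemLp g 2 μ) :
    Integrable (fun x => inner ℂ (f x) (g x)) μ := by
  refine (L2.integrable_inner (𝕜 := ℂ) hf.toLp hg.toLp).congr ?_
  filter_upwards [hf.coeFn_toLp, hg.coeFn_toLp] with x h1 h2
  rw [h1, h2]

theorem inner_toLp {f g : ℝ → E} (hf : MemLp f 2 μ) (hg : MemLp g 2 μ) :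
    inner ℂ hf.toLp hg.toLp = ∫ x, inner ℂ (f x) (g x) ∂μ := by
  rw [L2.inner_def]
  refine integral_congr_ae ?_
  filter_upwards [hf.coeFn_toLp, hg.coeFn_toLp] with x h1 h2
  rw [h1, h2]

theorem memLp_clm_apply {A : ℝ → E →L[ℂ] E} (hA : AEStronglyMeasurable A μ) {C : ℝ}
    (hC : ∀ᵐ x ∂μ, ‖A x‖ ≤ C) {g : ℝ → E} (hg : MemLp g 2 μ) :
    MemLp (fun x => A x (g x)) 2 μ := by
  refine hg.of_le_mul (c := C)
    (isBoundedBilinearMap_apply.continuous.comp_aestronglyMeasurable (hA.prodMk hg.1)) ?_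
  filter_upwards [hC] with x hx
  exact ((A x).le_opNorm _).trans (mul_le_mul_of_nonneg_right hx (norm_nonneg _))

/-- Multiplication by a bounded operator-valued function on `L²`. -/
noncomputable def mulL2 {A : ℝ → E →L[ℂ] E} (hA : AEStronglyMeasurable A μ) {C : ℝ}
    (hC : ∀ᵐ x ∂μ, ‖A x‖ ≤ C) : Lp E 2 μ →L[ℂ] Lp E 2 μ :=
  LinearMap.mkContinuous
    { toFun := fun g => (memLp_clm_apply hA hC (Lp.memLp g)).toLp
      map_add' := fun g h => by
        rw [← MemLp.toLp_add]
        refine (MemLp.toLp_eq_toLp_iff _ _).2 ?_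
        filter_upwards [Lp.coeFn_add g h] with x hx
        rw [hx, Pi.add_apply, Pi.add_apply, map_add]
      map_smul' := fun c g => by
        rw [RingHom.id_apply, ← MemLp.toLp_const_smul]
        refine (MemLp.toLp_eq_toLp_iff _ _).2 ?_
        filter_upwards [Lp.coeFn_smul c g] with x hx
        rw [hx, Pi.smul_apply, Pi.smul_apply, map_smul] }
    C
    fun g => by
      refine Lp.norm_le_mul_norm_of_ae_le_mul ?_
      filter_upwards [(memLp_clm_apply hA hC (Lp.memLp g)).coeFn_toLp, hC] with x hx hxC
      simp only [LinearMap.coe_mk, AddHom.coe_mk]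
      rw [hx]
      exact ((A x).le_opNorm _).trans (mul_le_mul_of_nonneg_right hxC (norm_nonneg _))

theorem mulL2_coeFn {A : ℝ → E →L[ℂ] E} (hA : AEStronglyMeasurable A μ) {C : ℝ}
    (hC : ∀ᵐ x ∂μ, ‖A x‖ ≤ C) (g : Lp E 2 μ) : mulL2 hA hC g =ᵐ[μ] fun x => A x (g x) :=
  (memLp_clm_apply hA hC (Lp.memLp g)).coeFn_toLp

variable [IsFiniteMeasure μ]

theorem memLp_balancedPrim {g : ℝ → E} (hg : Integrable g μ) (p : ENNReal) :
    MemLp (balancedPrim μ g) p μ :=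
  MemLp.of_bound (aestronglyMeasurable_balancedPrim hg) _
    (Eventually.of_forall fun x => norm_balancedPrim_le hg x)

/-- Integration as an operator on `L²` of a finite measure. -/
noncomputable def integralL2 (E : Type*) [NormedAddCommGroup E] [InnerProductSpace ℂ E]
    (μ : Measure ℝ) [IsFiniteMeasure μ] : Lp E 2 μ →L[ℂ] E :=
  LinearMap.mkContinuous
    { toFun := fun g => ∫ x, g x ∂μ
      map_add' := fun g h => by
        rw [integral_congr_ae (Lp.coeFn_add g h)]
        exact integral_add (integrable_of_memLp_two (Lp.memLp g))
          (integrable_of_memLp_two (Lp.memLp h))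
      map_smul' := fun c g => by
        rw [integral_congr_ae (Lp.coeFn_smul c g)]
        exact integral_smul c _ }
    (μ univ ^ (1 / (1 : ENNReal).toReal - 1 / (2 : ENNReal).toReal)).toReal
    fun g => (norm_integral_le_integral_norm _).trans (integral_norm_le_mul_norm g)

/-- The balanced primitive as an operator on `L²` of a finite measure. -/
noncomputable def primL2 (E : Type*) [NormedAddCommGroup E] [InnerProductSpace ℂ E]
    (μ : Measure ℝ) [IsFiniteMeasure μ] : Lp E 2 μ →L[ℂ] Lp E 2 μ :=
  LinearMap.mkContinuous
    { toFun := fun g => (memLp_balancedPrim (integrable_of_memLp_two (Lp.memLp g)) 2).toLp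
      map_add' := fun g h => by
        rw [← MemLp.toLp_add]
        congr 1
        rw [balancedPrim_congr (Lp.coeFn_add g h)]
        funext x
        simp only [balancedPrim, Pi.add_apply, smul_add]
        exact integral_add
          (integrable_stepKernel_smul (integrable_of_memLp_two (Lp.memLp g)) x)
          (integrable_stepKernel_smul (integrable_of_memLp_two (Lp.memLp h)) x)
      map_smul' := fun c g => by
        rw [RingHom.id_apply, ← MemLp.toLp_const_smul]
        congr 1
        rw [balancedPrim_congr (Lp.coeFn_smul c g)]
        funext x
        simp only [balancedPrim, Pi.smul_apply]
        rw [← integral_smul]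
        exact integral_congr_ae (Eventually.of_forall fun y => smul_comm _ _ _) }
    (measureUnivNNReal μ ^ (2 : ENNReal).toReal⁻¹ *
      (μ univ ^ (1 / (1 : ENNReal).toReal - 1 / (2 : ENNReal).toReal)).toReal)
    fun g => by
      rw [mul_assoc]
      refine Lp.norm_le_of_ae_bound (by positivity) ?_
      filter_upwards [(memLp_balancedPrim (integrable_of_memLp_two (Lp.memLp g)) 2).coeFn_toLp]
        with x hx
      simp only [LinearMap.coe_mk, AddHom.coe_mk]
      rw [hx]
      exact (norm_balancedPrim_le (integrable_of_memLp_two (Lp.memLp g)) x).trans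
        (integral_norm_le_mul_norm g)

theorem primL2_coeFn (g : Lp E 2 μ) : primL2 E μ g =ᵐ[μ] balancedPrim μ g :=
  (memLp_balancedPrim (integrable_of_memLp_two (Lp.memLp g)) 2).coeFn_toLp

variable [FiniteDimensional ℂ E]

/-- Evaluating the primitive at a point is a bounded functional on `L²`, represented by `y ↦
stepKernel x y • e`. Weak convergence of `g` therefore gives pointwise convergence of its
primitives. -/
theorem exists_inner_balancedPrim_eq (x : ℝ) (e : E) :
    ∃ z : Lp E 2 μ, ∀ g : Lp E 2 μ, inner ℂ (balancedPrim μ g x) e = inner ℂ g z := by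
  have : CompleteSpace E := FiniteDimensional.complete ℂ E
  have hz : MemLp (fun y => stepKernel x y • e) 2 μ :=
    MemLp.of_bound ((measurable_stepKernel_left x).aestronglyMeasurable.smul_const e) ‖e‖
      (Eventually.of_forall fun y => norm_stepKernel_smul_le x y e)
  refine ⟨hz.toLp, fun g => ?_⟩
  have hg := integrable_of_memLp_two (Lp.memLp g)
  rw [L2.inner_def, ← inner_conj_symm, balancedPrim,
    ← integral_inner (integrable_stepKernel_smul hg x), ← integral_conj]
  refine integral_congr_ae ?_
  filter_upwards [hz.coeFn_toLp] with y hy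
  rw [hy, inner_conj_symm, ← Complex.coe_smul, ← Complex.coe_smul, inner_smul_left,
    inner_smul_right, Complex.conj_ofReal]

/-- In finite dimension weak convergence is convergence: expand in an orthonormal basis. -/
theorem tendsto_of_tendsto_inner {v : ℕ → E} {x : E}
    (h : ∀ e : E, Tendsto (fun n => inner ℂ (v n) e) atTop (𝓝 (inner ℂ x e))) :
    Tendsto v atTop (𝓝 x) := by
  have key : ∀ z : E, z = ∑ i, inner ℂ (stdOrthonormalBasis ℂ E i) z • stdOrthonormalBasis ℂ E i :=
    fun z => ((stdOrthonormalBasis ℂ E).sum_repr' z).symm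
  rw [key x]
  refine (tendsto_finsetSum _ fun i _ => ?_).congr fun n => (key (v n)).symm
  refine Tendsto.smul_const ?_ _
  have := (Complex.continuous_conj.tendsto _).comp (h (stdOrthonormalBasis ℂ E i))
  simpa [Function.comp_def, inner_conj_symm] using this

/-- The balanced primitive is a compact operator on `L²`. -/
theorem exists_subseq_tendsto_primL2 (g : ℕ → Lp E 2 μ) (hg : ∀ n, ‖g n‖ ≤ 1) :
    ∃ φ : ℕ → ℕ, StrictMono φ ∧
      ∃ k, Tendsto (fun n => primL2 E μ (g (φ n))) atTop (𝓝 k) := by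
  have : CompleteSpace E := FiniteDimensional.complete ℂ E
  have : ProperSpace E := FiniteDimensional.proper ℂ E
  have : Fact ((2 : ENNReal) ≠ ⊤) := ⟨by norm_num⟩
  obtain ⟨φ, hφ, x, hx⟩ := exists_subseq_tendsto_inner g hg
  refine ⟨φ, hφ, primL2 E μ x, ?_⟩
  set C := (μ univ ^ (1 / (1 : ENNReal).toReal - 1 / (2 : ENNReal).toReal)).toReal with hC
  have hC0 : 0 ≤ C := ENNReal.toReal_nonneg
  have hb : ∀ (h : Lp E 2 μ) t, ‖balancedPrim μ h t‖ ≤ C * ‖h‖ := fun h t =>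
    (norm_balancedPrim_le (integrable_of_memLp_two (Lp.memLp h)) t).trans
      (integral_norm_le_mul_norm h)
  have hpt : ∀ t, Tendsto (fun n => balancedPrim μ (g (φ n)) t) atTop
      (𝓝 (balancedPrim μ x t)) := by
    intro t
    refine tendsto_of_tendsto_inner fun e => ?_
    obtain ⟨z, hz⟩ := exists_inner_balancedPrim_eq (μ := μ) t e
    simp only [hz]
    exact hx z
  -- The primitives converge pointwise and are uniformly bounded on a finite measure space, so
  -- dominated convergence gives convergence in `L²`.
  have hsq : Tendsto (fun n => inner ℂ (primL2 E μ (g (φ n)) - primL2 E μ x)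
      (primL2 E μ (g (φ n)) - primL2 E μ x)) atTop (𝓝 0) := by
    simp only [L2.inner_def]
    have h0 : (∫ t : ℝ, (0 : ℂ) ∂μ) = 0 := integral_zero _ _
    rw [← h0]
    refine tendsto_integral_of_dominated_convergence (fun _ => (C * 1 + C * ‖x‖) ^ 2)
      (fun n => (L2.integrable_inner _ _).1) (integrable_const _) (fun n => ?_) ?_
    · filter_upwards [Lp.coeFn_sub (primL2 E μ (g (φ n))) (primL2 E μ x),
        primL2_coeFn (g (φ n)), primL2_coeFn x] with t h1 h2 h3
      rw [h1, Pi.sub_apply, h2, h3, inner_self_eq_norm_sq_to_K, norm_pow]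
      simp only [Complex.coe_algebraMap, Complex.norm_real, norm_norm]
      gcongr
      refine (norm_sub_le _ _).trans (add_le_add ((hb _ _).trans ?_) (hb _ _))
      exact mul_le_mul_of_nonneg_left (hg _) hC0
    · have hall : ∀ᵐ t ∂μ, ∀ n, (primL2 E μ (g (φ n)) - primL2 E μ x : Lp E 2 μ) t =
          balancedPrim μ (g (φ n)) t - balancedPrim μ x t := by
        refine ae_all_iff.2 fun n => ?_
        filter_upwards [Lp.coeFn_sub (primL2 E μ (g (φ n))) (primL2 E μ x),
          primL2_coeFn (g (φ n)), primL2_coeFn x] with t h1 h2 h3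
        rw [h1, Pi.sub_apply, h2, h3]
      filter_upwards [hall] with t ht
      simp only [ht]
      have := (hpt t).sub_const (balancedPrim μ x t)
      rw [sub_self] at this
      simpa using this.inner (𝕜 := ℂ) this
  rw [tendsto_iff_norm_sub_tendsto_zero]
  have h2 := hsq.norm
  rw [norm_zero] at h2
  have h3 := (Real.continuous_sqrt.tendsto 0).comp h2
  rw [Real.sqrt_zero] at h3
  refine h3.congr fun n => ?_
  simp only [Function.comp_apply]
  rw [inner_self_eq_norm_sq_to_K, norm_pow]
  simp [Real.sqrt_sq]

/-- Integration by parts for the operator `g ↦ J g + A K g`, where `K` is the balanced primitive. -/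
theorem integral_inner_add_balancedPrim (J : E →L[ℂ] E)
    (hskew : ∀ x y, inner ℂ (J x) y = - inner ℂ x (J y))
    {A : ℝ → E →L[ℂ] E} (hA : AEStronglyMeasurable A μ) {C : ℝ}
    (hC : ∀ᵐ x ∂μ, ‖A x‖ ≤ C) {p h g : ℝ → E} (hp : MemLp p 2 μ) (hh : MemLp h 2 μ)
    (hg : MemLp g 2 μ)
    (hph : ∀ᵐ x ∂μ, ∀ e, inner ℂ (p x) (A x e) = - inner ℂ (J (h x)) e) :
    ∫ x, inner ℂ (p x) (J (g x) + A x (balancedPrim μ g x)) ∂μ =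
      ∫ x, inner ℂ (p x - balancedPrim μ h x) (J (g x)) ∂μ +
        inner ℂ (∫ x, h x ∂μ) (J (∫ x, g x ∂μ)) := by
  have : CompleteSpace E := FiniteDimensional.complete ℂ E
  have hgi := integrable_of_memLp_two hg
  have hhi := integrable_of_memLp_two hh
  have hJg : MemLp (fun x => J (g x)) 2 μ := J.comp_memLp' hg
  have hK := memLp_balancedPrim hgi 2
  have hKh := memLp_balancedPrim hhi 2
  have hJK : ∀ x, balancedPrim μ (fun y => J (g y)) x = J (balancedPrim μ g x) :=
    fun x => balancedPrim_comp (J.restrictScalars ℝ) hgi x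
  have e1 := integral_inner_balancedPrim_add (integrable_of_memLp_two hJg) hhi
  rw [J.integral_comp_comm hgi] at e1
  rw [← e1]
  simp only [inner_add_right, inner_sub_left]
  rw [integral_add (integrable_inner_of_memLp hp hJg)
      (integrable_inner_of_memLp hp (memLp_clm_apply hA hC hK)),
    integral_sub (integrable_inner_of_memLp hp hJg) (integrable_inner_of_memLp hKh hJg)]
  -- The hypothesis moves `A` off `p`, turning it into `-J h`; skewness then puts `J` on the
  -- primitive, where it commutes with integration.
  have e2 : ∫ x, inner ℂ (p x) (A x (balancedPrim μ g x)) ∂μ =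
      ∫ x, inner ℂ (h x) (balancedPrim μ (fun y => J (g y)) x) ∂μ := by
    refine integral_congr_ae ?_
    filter_upwards [hph] with x hx
    rw [hx, hJK, hskew, neg_neg]
  rw [e2]
  ring

end Hilbert

/-! ### The Fredholm alternative -/

section Fredholm

variable {E : Type*} [NormedAddCommGroup E] [InnerProductSpace ℂ E] [FiniteDimensional ℂ E]
  [CompleteSpace E] {μ : Measure ℝ} [IsFiniteMeasure μ]

/-- Define `h` by `J h = -A* v`. Integration by parts turns the orthogonality into `∫ ⟨v - K h, J g⟩
= 0` for every `g` of integral zero. As `J` is onto, `v - K h` is orthogonal to all functions of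
integral zero, hence constant. -/
theorem exists_ae_eq_of_orthogonal (J Ji : E →L[ℂ] E) (hiJ : ∀ x, J (Ji x) = x)
    (hskew : ∀ x y, inner ℂ (J x) y = - inner ℂ x (J y))
    {A : ℝ → E →L[ℂ] E} (hA : AEStronglyMeasurable A μ) {C : ℝ}
    (hC : ∀ᵐ x ∂μ, ‖A x‖ ≤ C) {v : ℝ → E} (hv : MemLp v 2 μ)
    (horth : ∀ g, MemLp g 2 μ → ∫ x, g x ∂μ = 0 →
      ∫ x, inner ℂ (v x) (J (g x) + A x (balancedPrim μ g x)) ∂μ = 0) :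
    ∃ c h, MemLp h 2 μ ∧ (∀ᵐ x ∂μ, v x = c + balancedPrim μ h x) ∧
      ∀ᵐ x ∂μ, J (h x) + (A x).adjoint (c + balancedPrim μ h x) = 0 := by
  have hA' : AEStronglyMeasurable (fun x => (A x).adjoint) μ :=
    (ContinuousLinearMap.adjoint (𝕜 := ℂ) (E := E) (F := E)).continuous.comp_aestronglyMeasurable hA
  have hC' : ∀ᵐ x ∂μ, ‖(A x).adjoint‖ ≤ C := by
    filter_upwards [hC] with x hx
    rwa [LinearIsometryEquiv.norm_map]
  set h : ℝ → E := fun x => -Ji ((A x).adjoint (v x)) with hh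
  have hhL : MemLp h 2 μ := (Ji.comp_memLp' (memLp_clm_apply hA' hC' hv)).neg
  have hJh : ∀ x, J (h x) = - (A x).adjoint (v x) := fun x => by simp [hh, hiJ]
  have hKh := memLp_balancedPrim (integrable_of_memLp_two hhL) 2
  set p : ℝ → E := fun x => v x - balancedPrim μ h x with hp
  have hpL : MemLp p 2 μ := hv.sub hKh
  -- The mean of `p`. Testing with `g = Ji (p - m)` yields `‖p - m‖² = 0` in `L²`. For `μ = 0` the
  -- inverse is 0 and nothing is lost.
  set m : E := (μ.real univ)⁻¹ • ∫ x, p x ∂μ with hm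
  have hpmL : MemLp (fun x => p x - m) 2 μ := hpL.sub (memLp_const m)
  have hpm0 : ∫ x, (p x - m) ∂μ = 0 := by
    rw [integral_sub (integrable_of_memLp_two hpL) (integrable_const m), integral_const, hm,
      smul_smul]
    rcases eq_or_ne (μ.real univ) 0 with h0 | h0
    · have : μ = 0 := by
        rwa [Measure.real, ENNReal.toReal_eq_zero_iff, or_iff_left (measure_ne_top μ univ),
          Measure.measure_univ_eq_zero] at h0
      simp [this]
    · rw [mul_inv_cancel₀ h0, one_smul, sub_self]
  have hgL : MemLp (fun x => Ji (p x - m)) 2 μ := Ji.comp_memLp' hpmL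
  have hg0 : ∫ x, Ji (p x - m) ∂μ = 0 := by
    rw [Ji.integral_comp_comm (integrable_of_memLp_two hpmL), hpm0, map_zero]
  have h1 := horth _ hgL hg0
  rw [integral_inner_add_balancedPrim J hskew hA hC hv hhL hgL (Eventually.of_forall fun x e => by
    rw [hJh, inner_neg_left, neg_neg, ContinuousLinearMap.adjoint_inner_left]), hg0, map_zero,
    inner_zero_right, add_zero] at h1
  simp only [hiJ] at h1
  have h2 : ∫ x, inner ℂ m (p x - m) ∂μ = 0 := by
    rw [integral_inner (integrable_of_memLp_two hpmL), hpm0, inner_zero_right]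
  have h3 : ∫ x, inner ℂ (p x - m) (p x - m) ∂μ = 0 := by
    have : ∀ x, inner ℂ (p x - m) (p x - m) = inner ℂ (p x) (p x - m) - inner ℂ m (p x - m) :=
      fun x => inner_sub_left _ _ _
    simp only [this]
    rw [integral_sub (integrable_inner_of_memLp hpL hpmL)
      (integrable_inner_of_memLp (memLp_const m) hpmL), h2, sub_zero]
    exact h1
  rw [← inner_toLp hpmL hpmL, inner_self_eq_zero] at h3
  have h4 := hpmL.coeFn_toLp.symm.trans (Lp.eq_zero_iff_ae_eq_zero.1 h3)
  have hvm : ∀ᵐ x ∂μ, v x = m + balancedPrim μ h x := by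
    filter_upwards [h4] with x hx
    have hx' : v x - balancedPrim μ h x - m = 0 := hx
    rw [← sub_eq_zero, ← hx']
    abel
  refine ⟨m, h, hhL, hvm, ?_⟩
  filter_upwards [hvm] with x hx
  rw [← hx, hJh, neg_add_cancel]

/-- Solvability of `J g + A K g = F` with `∫ g = 0`, where `K` is the balanced primitive. -/
theorem exists_integral_eq_zero_iff (J Ji : E →L[ℂ] E) (hJi : ∀ x, Ji (J x) = x)
    (hiJ : ∀ x, J (Ji x) = x) (hskew : ∀ x y, inner ℂ (J x) y = - inner ℂ x (J y))
    {A : ℝ → E →L[ℂ] E} (hA : AEStronglyMeasurable A μ) {C : ℝ}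
    (hC : ∀ᵐ x ∂μ, ‖A x‖ ≤ C) {F : ℝ → E} (hF : MemLp F 2 μ) :
    (∃ g, MemLp g 2 μ ∧ ∫ x, g x ∂μ = 0 ∧
        ∀ᵐ x ∂μ, J (g x) + A x (balancedPrim μ g x) = F x) ↔
      ∀ c h, MemLp h 2 μ →
        (∀ᵐ x ∂μ, J (h x) + (A x).adjoint (c + balancedPrim μ h x) = 0) →
        ∫ x, inner ℂ (c + balancedPrim μ h x) (F x) ∂μ = 0 := by
  constructor
  · rintro ⟨g, hg, hg0, hgF⟩ c h hh hch
    have hcK : MemLp (fun x => c + balancedPrim μ h x) 2 μ :=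
      (memLp_const c).add (memLp_balancedPrim (integrable_of_memLp_two hh) 2)
    have e1 : ∫ x, inner ℂ (c + balancedPrim μ h x) (F x) ∂μ =
        ∫ x, inner ℂ (c + balancedPrim μ h x) (J (g x) + A x (balancedPrim μ g x)) ∂μ := by
      refine integral_congr_ae ?_
      filter_upwards [hgF] with x hx
      rw [hx]
    -- Here `p - K h` is the constant `c`, so both remaining terms contain `∫ g = 0`.
    rw [e1, integral_inner_add_balancedPrim J hskew hA hC hcK hh hg]
    · simp only [add_sub_cancel_right]
      have hJg : Integrable (fun x => J (g x)) μ := integrable_of_memLp_two (J.comp_memLp' hg)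
      rw [integral_inner hJg, J.integral_comp_comm (integrable_of_memLp_two hg), hg0]
      simp
    · filter_upwards [hch] with x hx e
      rw [← inner_neg_left, ← eq_neg_of_add_eq_zero_right hx,
        ContinuousLinearMap.adjoint_inner_left]
  · intro hyp
    have hJm : AEStronglyMeasurable (fun _ : ℝ => J) μ := aestronglyMeasurable_const
    have hJim : AEStronglyMeasurable (fun _ : ℝ => Ji) μ := aestronglyMeasurable_const
    have hJb : ∀ᵐ x : ℝ ∂μ, ‖J‖ ≤ ‖J‖ := Eventually.of_forall fun _ => le_rfl
    have hJib : ∀ᵐ x : ℝ ∂μ, ‖Ji‖ ≤ ‖Ji‖ := Eventually.of_forall fun _ => le_rfl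
    set S := (mulL2 hA hC).comp (primL2 E μ) with hS
    set T := mulL2 hJm hJb + S with hT
    set N := (integralL2 E μ).ker with hN
    have hclosed : IsClosed ((N.map T.toLinearMap : Submodule ℂ (Lp E 2 μ)) : Set (Lp E 2 μ)) := by
      refine isClosed_map_add_compact _ (mulL2 hJim hJib) S (fun g => ?_) (fun g hg => ?_) N
        (integralL2 E μ).isClosed_ker
      · refine Lp.ext ?_
        filter_upwards [mulL2_coeFn hJim hJib (mulL2 hJm hJb g), mulL2_coeFn hJm hJb g]
          with x h1 h2
        rw [h1, h2, hJi]
      · obtain ⟨φ, hφ, k, hk⟩ := exists_subseq_tendsto_primL2 g hg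
        exact ⟨φ, hφ, mulL2 hA hC k, ((mulL2 hA hC).continuous.tendsto k).comp hk⟩
    have hTcoe : ∀ g : Lp E 2 μ, T g =ᵐ[μ] fun x => J (g x) + A x (balancedPrim μ g x) := by
      intro g
      filter_upwards [Lp.coeFn_add (mulL2 hJm hJb g) (mulL2 hA hC (primL2 E μ g)),
        mulL2_coeFn hJm hJb g, mulL2_coeFn hA hC (primL2 E μ g), primL2_coeFn g] with x h1 h2 h3 h4
      refine h1.trans ?_
      rw [Pi.add_apply, h2, h3, h4]
    have hmem : hF.toLp ∈ N.map T.toLinearMap := by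
      have : CompleteSpace (N.map T.toLinearMap) := hclosed.completeSpace_coe
      -- The image is closed, so it suffices that `F` is orthogonal to its orthogonal complement.
      rw [← Submodule.orthogonal_orthogonal (N.map T.toLinearMap), Submodule.mem_orthogonal]
      intro v hv
      obtain ⟨c, h, hh, hvc, hch⟩ := exists_ae_eq_of_orthogonal J Ji hiJ hskew hA hC
        (Lp.memLp v) (fun g hg hg0 => by
          have hgN : hg.toLp ∈ N := by
            rw [hN, LinearMap.mem_ker]
            exact (integral_congr_ae hg.coeFn_toLp).trans hg0
          have h1 := (Submodule.mem_orthogonal' _ _).1 hv _ (Submodule.mem_map_of_mem hgN)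
          rw [← h1, L2.inner_def]
          refine integral_congr_ae ?_
          filter_upwards [hTcoe hg.toLp, hg.coeFn_toLp] with x h2 h3
          have h4 : (T.toLinearMap hg.toLp : Lp E 2 μ) x = _ := h2
          rw [h4, h3, balancedPrim_congr hg.coeFn_toLp])
      have h1 := hyp c h hh hch
      rw [L2.inner_def, ← h1]
      refine integral_congr_ae ?_
      filter_upwards [hvc, hF.coeFn_toLp] with x h2 h3
      rw [h2, h3]
    obtain ⟨g, hgN, hgF⟩ := hmem
    refine ⟨g, Lp.memLp g, hgN, ?_⟩
    have h1 := hTcoe g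
    have hgF' : T g = hF.toLp := hgF
    rw [hgF'] at h1
    filter_upwards [h1, hF.coeFn_toLp] with x h2 h3
    rw [← h2, h3]

end Fredholm

/-! ### Filters at the endpoints -/

section EndpointFilters

/-- The filter of real points decreasing to the left endpoint. -/
noncomputable abbrev leftEnd (a : EReal) : Filter ℝ := comap ((↑) : ℝ → EReal) (𝓝[>] a)

/-- The filter of real points increasing to the right endpoint. -/
noncomputable abbrev rightEnd (b : EReal) : Filter ℝ := comap ((↑) : ℝ → EReal) (𝓝[<] b)

variable {a b : EReal}

theorem leftEnd_neBot (hab : a < b) : (leftEnd a).NeBot := by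
  refine comap_neBot_iff.2 fun t ht => ?_
  obtain ⟨c, hc, hct⟩ := (mem_nhdsGT_iff_exists_Ioo_subset' hab).1 ht
  obtain ⟨r, h1, h2⟩ := EReal.lt_iff_exists_real_btwn.1 hc
  exact ⟨r, hct ⟨h1, h2⟩⟩

theorem rightEnd_neBot (hab : a < b) : (rightEnd b).NeBot := by
  refine comap_neBot_iff.2 fun t ht => ?_
  obtain ⟨c, hc, hct⟩ := (mem_nhdsLT_iff_exists_Ioo_subset' hab).1 ht
  obtain ⟨r, h1, h2⟩ := EReal.lt_iff_exists_real_btwn.1 hc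
  exact ⟨r, hct ⟨h1, h2⟩⟩

theorem eventually_leftEnd_lt {y : ℝ} (hy : y ∈ interval a b) :
    ∀ᶠ x in leftEnd a, x ∈ interval a b ∧ x < y := by
  have h : ∀ᶠ z : EReal in 𝓝[>] a, a < z ∧ z < y := Ioo_mem_nhdsGT hy.1
  filter_upwards [h.comap ((↑) : ℝ → EReal)] with x hx
  exact ⟨⟨hx.1, hx.2.trans hy.2⟩, EReal.coe_lt_coe_iff.1 hx.2⟩

theorem eventually_rightEnd_gt {y : ℝ} (hy : y ∈ interval a b) :
    ∀ᶠ x in rightEnd b, x ∈ interval a b ∧ y < x := by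
  have h : ∀ᶠ z : EReal in 𝓝[<] b, y < z ∧ z < b := Ioo_mem_nhdsLT hy.2
  filter_upwards [h.comap ((↑) : ℝ → EReal)] with x hx
  exact ⟨⟨hy.1.trans hx.1, hx.2⟩, EReal.coe_lt_coe_iff.1 hx.1⟩

end EndpointFilters

/-! ### Limits and variation of balanced primitives -/

section PrimLimits

theorem locallyBoundedVariationOn_of_norm_sub_le {V : Type*} [NormedAddCommGroup V] {u : ℝ → V} {φ : ℝ → ℝ}
    (h : ∀ x x', x ≤ x' → ‖u x' - u x‖ ≤ φ x' - φ x) (s : Set ℝ) :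
    LocallyBoundedVariationOn u s := by
  have hφ : Monotone φ := fun x x' hx => sub_nonneg.1 ((norm_nonneg _).trans (h x x' hx))
  intro x y hx hy
  refine ne_top_of_le_ne_top ((hφ.monotoneOn s).locallyBoundedVariationOn x y hx hy) ?_
  refine iSup_mono fun p => Finset.sum_le_sum fun i _ => ?_
  have hp : p.2.1 i ≤ p.2.1 (i + 1) := p.2.2.1 (Nat.le_succ i)
  rw [edist_dist, edist_dist, dist_eq_norm, Real.dist_eq]
  exact ENNReal.ofReal_le_ofReal ((h _ _ hp).trans (le_abs_self _))

variable {V : Type*} [NormedAddCommGroup V] [NormedSpace ℝ V] {μ : Measure ℝ} {g : ℝ → V}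

/-- Dominated convergence with majorant `‖g‖`; the kernel only has to become constant along the
filter for almost every `y`. The one-sided limits and both endpoint limits are instances. -/
theorem tendsto_balancedPrim (hg : Integrable g μ) {l : Filter ℝ} [l.IsCountablyGenerated]
    {k : ℝ → ℝ} (hk : ∀ᵐ y ∂μ, ∀ᶠ x in l, stepKernel x y = k y) :
    Tendsto (balancedPrim μ g) l (𝓝 (∫ y, k y • g y ∂μ)) := by
  refine tendsto_integral_filter_of_dominated_convergence (fun y => ‖g y‖)
    (Eventually.of_forall fun x => (integrable_stepKernel_smul hg x).1)
    (Eventually.of_forall fun x => Eventually.of_forall fun y => norm_stepKernel_smul_le x y (g y))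
    hg.norm ?_
  filter_upwards [hk] with y hy
  refine tendsto_const_nhds.congr' ?_
  filter_upwards [hy] with x hx
  rw [hx]

theorem integral_indicator_one_smul {s : Set ℝ} (hs : MeasurableSet s) :
    ∫ y, s.indicator (1 : ℝ → ℝ) y • g y ∂μ = ∫ y in s, g y ∂μ := by
  rw [← integral_indicator hs]
  refine integral_congr_ae (Eventually.of_forall fun y => ?_)
  by_cases hy : y ∈ s <;> simp [hy]

theorem integrable_indicator_one_smul (hg : Integrable g μ) {s : Set ℝ} (hs : MeasurableSet s) :
    Integrable (fun y => s.indicator (1 : ℝ → ℝ) y • g y) μ := by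
  refine (hg.indicator hs).congr (Eventually.of_forall fun y => ?_)
  by_cases hy : y ∈ s <;> simp [hy]

theorem tendsto_balancedPrim_nhdsLT (hg : Integrable g μ) (x : ℝ) :
    Tendsto (balancedPrim μ g) (𝓝[<] x) (𝓝 (∫ y in Iio x, g y ∂μ)) := by
  rw [← integral_indicator_one_smul measurableSet_Iio]
  refine tendsto_balancedPrim hg (Eventually.of_forall fun y => ?_)
  rcases lt_or_ge y x with h | h
  · filter_upwards [Ioo_mem_nhdsLT h] with z hz
    simp [stepKernel, hz.1, h]
  · filter_upwards [self_mem_nhdsWithin] with z hz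
    have hz' : z < y := lt_of_lt_of_le hz h
    simp [stepKernel, hz'.not_gt, hz'.ne', h.not_gt]

theorem tendsto_balancedPrim_nhdsGT (hg : Integrable g μ) (x : ℝ) :
    Tendsto (balancedPrim μ g) (𝓝[>] x) (𝓝 (∫ y in Iic x, g y ∂μ)) := by
  rw [← integral_indicator_one_smul measurableSet_Iic]
  refine tendsto_balancedPrim hg (Eventually.of_forall fun y => ?_)
  rcases lt_or_ge x y with h | h
  · filter_upwards [Ioo_mem_nhdsGT h] with z hz
    simp [stepKernel, hz.2.not_gt, hz.2.ne', h.not_ge]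
  · filter_upwards [self_mem_nhdsWithin] with z hz
    have hz' : y < z := lt_of_le_of_lt h hz
    simp [stepKernel, hz', h]

/-- The kernel is the mean of the indicators of `Iio x` and `Iic x`, which is why the primitive is
balanced. -/
theorem balancedPrim_eq (hg : Integrable g μ) (x : ℝ) :
    balancedPrim μ g x = (2⁻¹ : ℝ) • (∫ y in Iio x, g y ∂μ + ∫ y in Iic x, g y ∂μ) := by
  rw [← integral_indicator_one_smul measurableSet_Iic,
    ← integral_indicator_one_smul measurableSet_Iio, ← integral_add, ← integral_smul]
  · refine integral_congr_ae (Eventually.of_forall fun y => ?_)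
    simp only [← add_smul, smul_smul]
    congr 1
    rcases lt_trichotomy y x with h | h | h
    · simp [stepKernel, h, h.le]; norm_num
    · simp [stepKernel, h]
    · simp [stepKernel, h.not_gt, h.ne', h.not_ge]
  · exact integrable_indicator_one_smul hg measurableSet_Iio
  · exact integrable_indicator_one_smul hg measurableSet_Iic

theorem leftLim_const_add_balancedPrim (hg : Integrable g μ) (c : V) (x : ℝ) :
    Function.leftLim (fun x => c + balancedPrim μ g x) x = c + ∫ y in Iio x, g y ∂μ :=
  leftLim_eq_of_tendsto (tendsto_const_nhds.add (tendsto_balancedPrim_nhdsLT hg x))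

theorem rightLim_const_add_balancedPrim (hg : Integrable g μ) (c : V) (x : ℝ) :
    Function.rightLim (fun x => c + balancedPrim μ g x) x = c + ∫ y in Iic x, g y ∂μ :=
  rightLim_eq_of_tendsto (tendsto_const_nhds.add (tendsto_balancedPrim_nhdsGT hg x))

theorem setIntegral_Iio_sub (hg : Integrable g μ) {s t : ℝ} (hst : s ≤ t) :
    ∫ y in Iio t, g y ∂μ - ∫ y in Iio s, g y ∂μ = ∫ y in Ico s t, g y ∂μ := by
  rw [← Iio_union_Ico_eq_Iio hst, setIntegral_union _ measurableSet_Ico hg.integrableOn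
    hg.integrableOn, add_sub_cancel_left]
  exact disjoint_left.2 fun y h1 h2 => (not_le.2 h1) h2.1

variable {a b : EReal}

theorem tendsto_balancedPrim_leftEnd (hμ : ∀ᵐ y ∂μ, y ∈ interval a b) (hg : Integrable g μ) :
    Tendsto (balancedPrim μ g) (leftEnd a) (𝓝 0) := by
  have : (∫ y, (0 : ℝ) • g y ∂μ) = 0 := by simp
  rw [← this]
  refine tendsto_balancedPrim hg ?_
  filter_upwards [hμ] with y hy
  filter_upwards [eventually_leftEnd_lt hy] with x hx
  simp [stepKernel, hx.2.not_gt, hx.2.ne']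

theorem tendsto_balancedPrim_rightEnd (hμ : ∀ᵐ y ∂μ, y ∈ interval a b) (hg : Integrable g μ) :
    Tendsto (balancedPrim μ g) (rightEnd b) (𝓝 (∫ y, g y ∂μ)) := by
  have : (∫ y, (1 : ℝ) • g y ∂μ) = ∫ y, g y ∂μ := by simp
  rw [← this]
  refine tendsto_balancedPrim hg ?_
  filter_upwards [hμ] with y hy
  filter_upwards [eventually_rightEnd_gt hy] with x hx
  simp [stepKernel, hx.2]

theorem norm_balancedPrim_sub_le (hg : Integrable g μ) {x x' : ℝ} (hx : x ≤ x') :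
    ‖balancedPrim μ g x' - balancedPrim μ g x‖ ≤
      balancedPrim μ (fun y => ‖g y‖) x' - balancedPrim μ (fun y => ‖g y‖) x := by
  simp only [balancedPrim]
  rw [← integral_sub (integrable_stepKernel_smul hg x') (integrable_stepKernel_smul hg x),
    ← integral_sub (integrable_stepKernel_smul hg.norm x') (integrable_stepKernel_smul hg.norm x)]
  refine norm_integral_le_of_norm_le ((integrable_stepKernel_smul hg.norm x').sub
    (integrable_stepKernel_smul hg.norm x)) (Eventually.of_forall fun y => ?_)
  rw [← sub_smul, norm_smul, Real.norm_of_nonneg (sub_nonneg.2 (stepKernel_mono y hx)),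
    smul_eq_mul, smul_eq_mul, sub_mul]

theorem isBalancedBV_const_add_balancedPrim {n : ℕ} {g : ℝ → Fin n → ℂ} (hg : Integrable g μ)
    (c : Fin n → ℂ) : IsBalancedBV a b (fun x => c + balancedPrim μ g x) := by
  refine ⟨locallyBoundedVariationOn_of_norm_sub_le
    (φ := balancedPrim μ (fun y => ‖g y‖)) (fun x x' hx => ?_) _, fun x _ => ?_⟩
  · rw [add_sub_add_left_eq_sub]
    exact norm_balancedPrim_sub_le hg hx
  · rw [leftLim_const_add_balancedPrim hg, rightLim_const_add_balancedPrim hg]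
    simp only [balancedPrim_eq hg]
    ext i
    simp
    ring

end PrimLimits

/-! ### One-sided limits of functions of locally bounded variation -/

section BV

variable {V : Type*} [NormedAddCommGroup V] {a b : EReal} {u : ℝ → V}

theorem exists_lt_mem_interval {x : ℝ} (hx : x ∈ interval a b) : ∃ s ∈ interval a b, s < x := by
  obtain ⟨r, h1, h2⟩ := EReal.lt_iff_exists_real_btwn.1 hx.1
  exact ⟨r, ⟨h1, h2.trans hx.2⟩, EReal.coe_lt_coe_iff.1 h2⟩

theorem exists_gt_mem_interval {x : ℝ} (hx : x ∈ interval a b) : ∃ t ∈ interval a b, x < t := by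
  obtain ⟨r, h1, h2⟩ := EReal.lt_iff_exists_real_btwn.1 hx.2
  exact ⟨r, ⟨hx.1.trans h1, h2⟩, EReal.coe_lt_coe_iff.1 h1⟩

theorem boundedVariationOn_Icc (hu : LocallyBoundedVariationOn u (interval a b)) {s t : ℝ}
    (hs : s ∈ interval a b) (ht : t ∈ interval a b) : BoundedVariationOn u (Icc s t) := by
  have := hu s t hs ht
  rwa [inter_eq_right.2 ((interval_ordConnected a b).out hs ht)] at this

theorem exists_norm_le_on_Icc (hu : LocallyBoundedVariationOn u (interval a b)) {s t : ℝ}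
    (hs : s ∈ interval a b) (ht : t ∈ interval a b) : ∃ B, ∀ x ∈ Icc s t, ‖u x‖ ≤ B := by
  have h := boundedVariationOn_Icc hu hs ht
  refine ⟨‖u s‖ + (eVariationOn u (Icc s t)).toReal, fun x hx => ?_⟩
  have h1 := h.dist_le hx (left_mem_Icc.2 (hx.1.trans hx.2))
  rw [dist_eq_norm] at h1
  have h2 := norm_sub_norm_le (u x) (u s)
  linarith

section Limits

variable [CompleteSpace V]

theorem tendsto_leftLim_of_locallyBV (hu : LocallyBoundedVariationOn u (interval a b)) {x : ℝ}
    (hx : x ∈ interval a b) : Tendsto u (𝓝[<] x) (𝓝 (Function.leftLim u x)) := by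
  obtain ⟨s, hs, hsx⟩ := exists_lt_mem_interval hx
  obtain ⟨l, hl⟩ := (boundedVariationOn_Icc hu hs hx).exists_tendsto_left x
  refine tendsto_leftLim_of_tendsto ⟨l, hl.mono_left (le_of_eq ?_)⟩
  refine nhdsWithin_eq_nhdsWithin' (Ioi_mem_nhds hsx) ?_
  ext y
  simp only [mem_inter_iff, mem_Iio, mem_Ioi, mem_Icc]
  constructor
  · rintro ⟨h1, h2⟩
    exact ⟨⟨⟨h2.le, h1.le⟩, h1⟩, h2⟩
  · rintro ⟨⟨-, h1⟩, h2⟩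
    exact ⟨h1, h2⟩

theorem tendsto_rightLim_of_locallyBV (hu : LocallyBoundedVariationOn u (interval a b)) {x : ℝ}
    (hx : x ∈ interval a b) : Tendsto u (𝓝[>] x) (𝓝 (Function.rightLim u x)) := by
  obtain ⟨t, ht, hxt⟩ := exists_gt_mem_interval hx
  obtain ⟨l, hl⟩ := (boundedVariationOn_Icc hu hx ht).exists_tendsto_right x
  refine tendsto_rightLim_of_tendsto ⟨l, hl.mono_left (le_of_eq ?_)⟩
  refine nhdsWithin_eq_nhdsWithin' (Iio_mem_nhds hxt) ?_
  ext y
  simp only [mem_inter_iff, mem_Iio, mem_Ioi, mem_Icc]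
  constructor
  · rintro ⟨h1, h2⟩
    exact ⟨⟨⟨h1.le, h2.le⟩, h1⟩, h2⟩
  · rintro ⟨⟨-, h1⟩, h2⟩
    exact ⟨h1, h2⟩

/-- For `z` just to the right of `x`, the left limit at `z` is a limit of values taken between `x`
and `z`, so it stays in any closed neighbourhood of the right limit at `x`. The equation controls
only left limits; this recovers the right ones. -/
theorem tendsto_leftLim_nhdsGT (hu : LocallyBoundedVariationOn u (interval a b)) {x : ℝ}
    (hx : x ∈ interval a b) :
    Tendsto (Function.leftLim u) (𝓝[>] x) (𝓝 (Function.rightLim u x)) := by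
  refine (closed_nhds_basis _).tendsto_right_iff.2 ?_
  rintro S ⟨hS, hSc⟩
  obtain ⟨t, ht, hxt⟩ := exists_gt_mem_interval hx
  obtain ⟨y, hy, hyS⟩ := (mem_nhdsGT_iff_exists_Ioo_subset' hxt).1
    (tendsto_rightLim_of_locallyBV hu hx hS)
  filter_upwards [Ioo_mem_nhdsGT (lt_min hy hxt)] with z hz
  have hzI : z ∈ interval a b :=
    (interval_ordConnected a b).out hx ht ⟨hz.1.le, (hz.2.trans_le (min_le_right _ _)).le⟩
  refine hSc.mem_of_tendsto (tendsto_leftLim_of_locallyBV hu hzI) ?_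
  filter_upwards [Ioo_mem_nhdsLT hz.1] with r hr
  exact hyS ⟨hr.1, hr.2.trans (hz.2.trans_le (min_le_left _ _))⟩

theorem exists_norm_leftLim_le_on_Icc (hu : LocallyBoundedVariationOn u (interval a b)) {s t : ℝ}
    (hs : s ∈ interval a b) (ht : t ∈ interval a b) :
    ∃ B, ∀ x ∈ Icc s t, ‖Function.leftLim u x‖ ≤ B := by
  obtain ⟨s', hs', hss'⟩ := exists_lt_mem_interval hs
  obtain ⟨B, hB⟩ := exists_norm_le_on_Icc hu hs' ht
  refine ⟨B, fun x hx => ?_⟩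
  have hxI := (interval_ordConnected a b).out hs ht hx
  refine le_of_tendsto (tendsto_leftLim_of_locallyBV hu hxI).norm ?_
  filter_upwards [Ioo_mem_nhdsLT (hss'.trans_le hx.1)] with y hy
  exact hB y ⟨hy.1.le, hy.2.le.trans hx.2⟩

end Limits

/-- Real and imaginary parts of each component are differences of functions monotone on the
interval. -/
theorem aestronglyMeasurable_of_locallyBV {n : ℕ} {u : ℝ → Fin n → ℂ} {μ : Measure ℝ}
    (hμ : ∀ᵐ y ∂μ, y ∈ interval a b) (hu : LocallyBoundedVariationOn u (interval a b)) :
    AEStronglyMeasurable u μ := by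
  have hreal : ∀ v : ℝ → ℝ, LocallyBoundedVariationOn v (interval a b) → AEMeasurable v μ := by
    intro v hv
    obtain ⟨p, q, hp, hq, rfl⟩ := hv.exists_monotoneOn_sub_monotoneOn
    have hI := (isOpen_interval a b).measurableSet
    rw [← Measure.restrict_eq_self_of_ae_mem hμ]
    exact (aemeasurable_restrict_of_monotoneOn hI hp).sub
      (aemeasurable_restrict_of_monotoneOn hI hq)
  refine AEMeasurable.aestronglyMeasurable (aemeasurable_pi_iff.2 fun i => ?_)
  have hre := hreal (fun x => (u x i).re) (LipschitzWith.comp_locallyBoundedVariationOn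
    (f := fun z : Fin n → ℂ => (z i).re)
    ((Complex.reCLM.comp (ContinuousLinearMap.proj (R := ℝ) (φ := fun _ : Fin n => ℂ) i)).lipschitz)
    hu)
  have him := hreal (fun x => (u x i).im) (LipschitzWith.comp_locallyBoundedVariationOn
    (f := fun z : Fin n → ℂ => (z i).im)
    ((Complex.imCLM.comp (ContinuousLinearMap.proj (R := ℝ) (φ := fun _ : Fin n => ℂ) i)).lipschitz)
    hu)
  have : (fun x => u x i) = fun x => ((u x i).re : ℂ) + ((u x i).im : ℂ) * Complex.I :=
    funext fun x => (Complex.re_add_im _).symm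
  rw [this]
  exact (Complex.measurable_ofReal.comp_aemeasurable hre).add
    ((Complex.measurable_ofReal.comp_aemeasurable him).mul_const _)

/-! ### Gronwall estimates and boundedness -/

section Gronwall

variable {n : ℕ} {u : ℝ → Fin n → ℂ} {μ : Measure ℝ} [IsFiniteMeasure μ]

/-- Right limits at `x < t` are limits of left limits inside `[s, t]`, so they obey the same bound,
and so does the average. At `t` the right limit is not controlled, hence the half-open interval. -/
theorem norm_le_of_norm_leftLim_le (hu : IsBalancedBV a b u) {s t S : ℝ} (hs : s ∈ interval a b)
    (ht : t ∈ interval a b) (hS : ∀ x ∈ Icc s t, ‖Function.leftLim u x‖ ≤ S) :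
    ∀ x ∈ Ico s t, ‖u x‖ ≤ S := by
  intro x hx
  have hxI := (interval_ordConnected a b).out hs ht ⟨hx.1, hx.2.le⟩
  have hR : ‖Function.rightLim u x‖ ≤ S := by
    refine le_of_tendsto (tendsto_leftLim_nhdsGT hu.1 hxI).norm ?_
    filter_upwards [Ioo_mem_nhdsGT hx.2] with y hy
    exact hS y ⟨hx.1.trans hy.1.le, hy.2.le⟩
  rw [hu.2 x hxI, norm_smul]
  have h1 := norm_add_le (Function.leftLim u x) (Function.rightLim u x)
  have h2 := hS x ⟨hx.1, hx.2.le⟩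
  have h3 : ‖(2⁻¹ : ℂ)‖ = 2⁻¹ := by simp
  rw [h3]
  linarith

/-- A Gronwall estimate on an interval of small mass. -/
theorem norm_le_of_small_mass (hu : IsBalancedBV a b u) {A κ : ℝ} (hκ : 0 ≤ κ)
    (h : ∀ s ∈ interval a b, ∀ t ∈ interval a b, s ≤ t → ∀ M, (∀ x ∈ Ico s t, ‖u x‖ ≤ M) →
      0 ≤ M → ‖Function.leftLim u t - Function.leftLim u s‖ ≤ A + κ * M * μ.real (Ico s t))
    {s t p : ℝ} (hs : s ∈ interval a b) (ht : t ∈ interval a b) (hp : p ∈ Icc s t)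
    (hsmall : κ * μ.real (Ico s t) ≤ 1 / 2) :
    ∀ x ∈ Ico s t, ‖u x‖ ≤ 2 * (‖Function.leftLim u p‖ + A) := by
  obtain ⟨B, hB⟩ := exists_norm_leftLim_le_on_Icc hu.1 hs ht
  set T : Set ℝ := (fun x => ‖Function.leftLim u x‖) '' Icc s t with hT
  have hbdd : BddAbove T := ⟨B, by rintro _ ⟨x, hx, rfl⟩; exact hB x hx⟩
  have hne : T.Nonempty := ⟨_, p, hp, rfl⟩
  have hle : ∀ x ∈ Icc s t, ‖Function.leftLim u x‖ ≤ sSup T := fun x hx =>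
    le_csSup hbdd ⟨x, hx, rfl⟩
  have hS0 : 0 ≤ sSup T := (norm_nonneg _).trans (hle p hp)
  have hu' := norm_le_of_norm_leftLim_le hu hs ht hle
  have hdiff : ∀ y ∈ Icc s t, ∀ z ∈ Icc s t, y ≤ z →
      ‖Function.leftLim u z - Function.leftLim u y‖ ≤ A + sSup T / 2 := by
    intro y hy z hz hyz
    have hOC := (interval_ordConnected a b).out hs ht
    refine (h y (hOC hy) z (hOC hz) hyz (sSup T)
      (fun x hx => hu' x ⟨hy.1.trans hx.1, hx.2.trans_le hz.2⟩) hS0).trans ?_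
    have hm : μ.real (Ico y z) ≤ μ.real (Ico s t) :=
      measureReal_mono (Ico_subset_Ico hy.1 hz.2)
    have : κ * sSup T * μ.real (Ico y z) ≤ sSup T * (1 / 2) := by
      calc κ * sSup T * μ.real (Ico y z) ≤ κ * sSup T * μ.real (Ico s t) := by gcongr
        _ = sSup T * (κ * μ.real (Ico s t)) := by ring
        _ ≤ sSup T * (1 / 2) := by gcongr
    linarith
  -- The small mass lets the finite supremum absorb half of itself, which is the source of the
  -- factor 2 in the bound.
  have hsup : sSup T ≤ ‖Function.leftLim u p‖ + (A + sSup T / 2) := by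
    refine csSup_le hne ?_
    rintro _ ⟨x, hx, rfl⟩
    have h1 : ‖Function.leftLim u x - Function.leftLim u p‖ ≤ A + sSup T / 2 := by
      rcases le_total x p with hxp | hxp
      · rw [norm_sub_rev]
        exact hdiff x hx p hp hxp
      · exact hdiff p hp x hx hxp
    have h2 := norm_sub_norm_le (Function.leftLim u x) (Function.leftLim u p)
    simp only
    linarith
  intro x hx
  have := hu' x hx
  linarith

/-- A balanced function whose increments satisfy a Gronwall condition with respect to a finite
measure is bounded. -/
theorem exists_norm_le_of_gronwall (hab : a < b) (hμ : ∀ᵐ y ∂μ, y ∈ interval a b)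
    (hu : IsBalancedBV a b u) {A κ : ℝ} (hκ : 0 ≤ κ)
    (h : ∀ s ∈ interval a b, ∀ t ∈ interval a b, s ≤ t → ∀ M, (∀ x ∈ Ico s t, ‖u x‖ ≤ M) →
      0 ≤ M → ‖Function.leftLim u t - Function.leftLim u s‖ ≤ A + κ * M * μ.real (Ico s t)) :
    ∃ B, ∀ x ∈ interval a b, ‖u x‖ ≤ B := by
  have hone : Integrable (fun _ : ℝ => (1 : ℝ)) μ := integrable_const 1
  obtain ⟨r, hr1, hr2⟩ := EReal.lt_iff_exists_real_btwn.1 hab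
  have hrI : r ∈ interval a b := ⟨hr1, hr2⟩
  have := leftEnd_neBot hab
  have := rightEnd_neBot hab
  obtain ⟨s₀, hs₀I, hs₀⟩ : ∃ s ∈ interval a b, κ * μ.real (Iio s) ≤ 1 / 2 := by
    have h1 := (tendsto_balancedPrim_leftEnd hμ hone).const_mul κ
    rw [mul_zero] at h1
    obtain ⟨s, hs, hsI, -⟩ := ((h1.eventually (gt_mem_nhds (show (0 : ℝ) < 1 / 2 by norm_num))).and
      (eventually_leftEnd_lt hrI)).exists
    refine ⟨s, hsI, le_trans ?_ hs.le⟩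
    gcongr
    rw [balancedPrim_eq hone]
    simp only [integral_const, measureReal_restrict_apply_univ, smul_eq_mul, mul_one]
    have : μ.real (Iio s) ≤ μ.real (Iic s) := measureReal_mono Iio_subset_Iic_self
    linarith
  obtain ⟨t₀, ht₀I, ht₀⟩ : ∃ t ∈ interval a b, κ * μ.real (Ici t) ≤ 1 / 2 := by
    -- The total mass minus the balanced primitive of 1 at `t` is at least half of `μ (Ici t)`; the
    -- extra 2 compensates.
    have h1 := ((tendsto_balancedPrim_rightEnd hμ hone).const_sub (∫ _, 1 ∂μ)).const_mul (κ * 2)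
    rw [sub_self, mul_zero] at h1
    obtain ⟨t, ht, htI, -⟩ := ((h1.eventually (gt_mem_nhds (show (0 : ℝ) < 1 / 2 by norm_num))).and
      (eventually_rightEnd_gt hrI)).exists
    refine ⟨t, htI, le_trans ?_ ht.le⟩
    rw [mul_assoc]
    gcongr
    rw [balancedPrim_eq hone]
    simp only [integral_const, measureReal_restrict_apply_univ, smul_eq_mul, mul_one]
    have h2 : μ.real (Iic t) ≤ μ.real univ := measureReal_mono (subset_univ _)
    have h3 : μ.real (Iio t) + μ.real (Ici t) = μ.real univ := by
      rw [← compl_Iio]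
      exact measureReal_add_measureReal_compl measurableSet_Iio
    linarith
  obtain ⟨B, hB⟩ := exists_norm_le_on_Icc hu.1 hs₀I ht₀I
  refine ⟨max B (max (2 * (‖Function.leftLim u s₀‖ + A)) (2 * (‖Function.leftLim u t₀‖ + A))),
    fun x hx => ?_⟩
  rcases lt_or_ge x s₀ with hxs | hxs
  · refine le_max_of_le_right (le_max_of_le_left ?_)
    refine norm_le_of_small_mass hu hκ h hx hs₀I ⟨hxs.le, le_rfl⟩ (le_trans ?_ hs₀) x
      ⟨le_rfl, hxs⟩
    gcongr
    · finiteness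
    · exact fun y hy => hy.2
  · rcases lt_or_ge x t₀ with hxt | hxt
    · exact le_max_of_le_left (hB x ⟨hxs, hxt.le⟩)
    · refine le_max_of_le_right (le_max_of_le_right ?_)
      -- The small-mass bound holds on half-open intervals, so an endpoint beyond `x` is needed; the
      -- bound does not depend on it.
      obtain ⟨t, htI, hxt'⟩ := exists_gt_mem_interval hx
      refine norm_le_of_small_mass hu hκ h ht₀I htI ⟨le_rfl, hxt.trans hxt'.le⟩ (le_trans ?_ ht₀) x
        ⟨hxt, hxt'⟩
      gcongr
      · finiteness
      · exact fun y hy => hy.1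

end Gronwall

/-- A balanced function whose left limits have increments `∫ g` is a primitive of `g`. -/
theorem eq_const_add_balancedPrim {n : ℕ} {u g : ℝ → Fin n → ℂ} {μ : Measure ℝ} (hab : a < b)
    (hu : IsBalancedBV a b u) (hg : Integrable g μ)
    (h : ∀ s ∈ interval a b, ∀ t ∈ interval a b, s ≤ t →
      Function.leftLim u t - Function.leftLim u s = ∫ x in Ico s t, g x ∂μ) :
    ∃ c, ∀ x ∈ interval a b, u x = c + balancedPrim μ g x := by
  obtain ⟨r, hr1, hr2⟩ := EReal.lt_iff_exists_real_btwn.1 hab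
  have hrI : r ∈ interval a b := ⟨hr1, hr2⟩
  set c := Function.leftLim u r - ∫ y in Iio r, g y ∂μ with hc
  have hL : ∀ x ∈ interval a b, Function.leftLim u x = c + ∫ y in Iio x, g y ∂μ := by
    have aux : ∀ s ∈ interval a b, ∀ t ∈ interval a b, s ≤ t →
        Function.leftLim u t - ∫ y in Iio t, g y ∂μ =
          Function.leftLim u s - ∫ y in Iio s, g y ∂μ := by
      intro s hs t ht hst
      have h1 := h s hs t ht hst
      rw [← setIntegral_Iio_sub hg hst] at h1
      rw [sub_eq_sub_iff_sub_eq_sub, h1]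
    intro x hx
    rw [← sub_eq_iff_eq_add, hc]
    rcases le_total x r with hxr | hxr
    · exact (aux x hx r hrI hxr).symm
    · exact aux r hrI x hx hxr
  refine ⟨c, fun x hx => ?_⟩
  -- `u` and `c + K g` share their left limits, hence also the limits of these from the right.
  have hR : Function.rightLim u x = c + ∫ y in Iic x, g y ∂μ := by
    have h1 := tendsto_leftLim_nhdsGT hu.1 hx
    have h2 : Tendsto (Function.leftLim fun x => c + balancedPrim μ g x) (𝓝[>] x)
        (𝓝 (Function.rightLim (fun x => c + balancedPrim μ g x) x)) :=
      tendsto_leftLim_nhdsGT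
        (isBalancedBV_const_add_balancedPrim (a := a) (b := b) hg c).1 hx
    rw [rightLim_const_add_balancedPrim hg] at h2
    refine tendsto_nhds_unique (h1.congr' ?_) h2
    obtain ⟨t, ht, hxt⟩ := exists_gt_mem_interval hx
    filter_upwards [Ioo_mem_nhdsGT hxt] with y hy
    rw [hL y ((interval_ordConnected a b).out hx ht ⟨hy.1.le, hy.2.le⟩),
      leftLim_const_add_balancedPrim hg]
  rw [hu.2 x hx, hL x hx, hR, balancedPrim_eq hg]
  ext i
  simp
  ring

end BV

/-! ### Closed cones, positive matrices and bounded derivatives -/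

theorem tendsto_setIntegral_Ico_nhdsGT {V : Type*} [NormedAddCommGroup V] [NormedSpace ℝ V]
    {μ : Measure ℝ} {g : ℝ → V} (hg : Integrable g μ) (s t : ℝ) :
    Tendsto (fun z => ∫ y in Ico s z, g y ∂μ) (𝓝[>] t) (𝓝 (∫ y in Icc s t, g y ∂μ)) := by
  simp only [← integral_indicator measurableSet_Ico, ← integral_indicator measurableSet_Icc]
  refine tendsto_integral_filter_of_dominated_convergence (fun y => ‖g y‖)
    (Eventually.of_forall fun x => (hg.indicator measurableSet_Ico).1)
    (Eventually.of_forall fun x => Eventually.of_forall fun y => norm_indicator_le_norm_self _ _)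
    hg.norm (Eventually.of_forall fun y => ?_)
  refine tendsto_const_nhds.congr' ?_
  rcases le_or_gt y t with h | h
  · filter_upwards [self_mem_nhdsWithin] with z hz
    have hz' : y < z := lt_of_le_of_lt h hz
    by_cases hs : s ≤ y <;> simp [indicator, h, hz', hs]
  · filter_upwards [Ioo_mem_nhdsGT h] with z hz
    simp [indicator, h.not_ge, hz.2.not_gt]

theorem isClosed_setOf_isHermitian (n : ℕ) :
    IsClosed {M : Matrix (Fin n) (Fin n) ℂ | M.IsHermitian} :=
  isClosed_eq (by fun_prop) continuous_id

theorem isClosed_setOf_posSemidef (n : ℕ) :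
    IsClosed {M : Matrix (Fin n) (Fin n) ℂ | M.PosSemidef} := by
  simp only [Matrix.posSemidef_iff_dotProduct_mulVec, ofPred_and, ofPred_forall]
  refine (isClosed_setOf_isHermitian n).inter (isClosed_iInter fun x => ?_)
  exact isClosed_le continuous_const (by fun_prop)

/-- Write `M = ∑ v_k v_k*` and `c_k = v_k* f`. Then `M f = ∑ c_k v_k` and `f* M f = ∑ |c_k|²`.
Cauchy–Schwarz in coordinate `i` costs the diagonal entry `∑ |v_k i|² ≤ C`, and the sup norm adds no
factor `n`. -/
theorem norm_mulVec_sq_le {n : ℕ} {M : Matrix (Fin n) (Fin n) ℂ} (hM : M.PosSemidef) {C : ℝ}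
    (hC : ∀ i j, ‖M i j‖ ≤ C) (f : Fin n → ℂ) :
    ‖M *ᵥ f‖ ^ 2 ≤ C * (star f ⬝ᵥ (M *ᵥ f)).re := by
  obtain ⟨m, v, rfl⟩ := Matrix.posSemidef_iff_eq_sum_vecMulVec.1 hM
  set c : Fin m → ℂ := fun k => star (v k) ⬝ᵥ f with hc
  have hmul : (∑ k, Matrix.vecMulVec (v k) (star (v k))) *ᵥ f = ∑ k, c k • v k := by
    rw [Matrix.sum_mulVec]
    refine Finset.sum_congr rfl fun k _ => ?_
    rw [Matrix.vecMulVec_mulVec]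
    ext i
    simp [hc, mul_comm]
  have hR : (star f ⬝ᵥ ((∑ k, Matrix.vecMulVec (v k) (star (v k))) *ᵥ f)).re =
      ∑ k, ‖c k‖ ^ 2 := by
    rw [hmul, dotProduct_sum, Complex.re_sum]
    refine Finset.sum_congr rfl fun k _ => ?_
    have h1 : star f ⬝ᵥ v k = star (c k) := by
      simp only [hc]
      exact Matrix.star_dotProduct _ _
    rw [dotProduct_smul, h1, smul_eq_mul, Complex.star_def, Complex.mul_conj,
      Complex.ofReal_re, Complex.normSq_eq_norm_sq]
  have hdiag : ∀ i, ∑ k, ‖v k i‖ ^ 2 ≤ C := by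
    intro i
    refine le_trans (le_of_eq ?_) ((Complex.re_le_norm _).trans (hC i i))
    rw [Matrix.sum_apply, Complex.re_sum]
    refine Finset.sum_congr rfl fun k _ => ?_
    rw [Matrix.vecMulVec_apply, Pi.star_apply, Complex.star_def, Complex.mul_conj,
      Complex.ofReal_re, Complex.normSq_eq_norm_sq]
  rw [hR, hmul]
  -- For `n = 0` the hypothesis does not force `0 ≤ C`.
  rcases isEmpty_or_nonempty (Fin n) with hn | ⟨⟨i₀⟩⟩
  · have : c = 0 := funext fun k => by simp [hc, dotProduct]
    simp [this]
  have hC0 : 0 ≤ C := (Finset.sum_nonneg fun k _ => sq_nonneg _).trans (hdiag i₀)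
  have hS0 : 0 ≤ ∑ k, ‖c k‖ ^ 2 := Finset.sum_nonneg fun k _ => sq_nonneg _
  refine (Real.le_sqrt (norm_nonneg _) (mul_nonneg hC0 hS0)).1
    ((pi_norm_le_iff_of_nonneg (Real.sqrt_nonneg _)).2 fun i => ?_)
  refine (Real.le_sqrt (norm_nonneg _) (mul_nonneg hC0 hS0)).2 ?_
  calc ‖(∑ k, c k • v k) i‖ ^ 2 ≤ (∑ k, ‖c k‖ * ‖v k i‖) ^ 2 := by
        gcongr
        rw [Finset.sum_apply]
        refine (norm_sum_le _ _).trans (le_of_eq (Finset.sum_congr rfl fun k _ => ?_))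
        rw [Pi.smul_apply, smul_eq_mul, norm_mul]
    _ ≤ (∑ k, ‖c k‖ ^ 2) * ∑ k, ‖v k i‖ ^ 2 := Finset.sum_mul_sq_le_sq_mul_sq _ _ _
    _ ≤ (∑ k, ‖c k‖ ^ 2) * C := by gcongr; exact hdiag i
    _ = C * ∑ k, ‖c k‖ ^ 2 := mul_comm _ _

/-- Both Jordan parts are dominated by `μ`, so the derivative is a difference of two functions with
values in `[0, 1]`. -/
theorem abs_rnDeriv_le_one {s : SignedMeasure ℝ} {μ : Measure ℝ}
    [IsFiniteMeasure μ] (h : s.totalVariation ≤ μ) : ∀ᵐ x ∂μ, |s.rnDeriv μ x| ≤ 1 := by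
  have hp : s.toJordanDecomposition.posPart ≤ μ := (Measure.le_add_right le_rfl).trans h
  have hn : s.toJordanDecomposition.negPart ≤ μ := (Measure.le_add_left le_rfl).trans h
  filter_upwards [Measure.rnDeriv_le_one_of_le hp, Measure.rnDeriv_le_one_of_le hn] with x h1 h2
  have h1' : (s.toJordanDecomposition.posPart.rnDeriv μ x).toReal ≤ 1 := by
    simpa using ENNReal.toReal_mono ENNReal.one_ne_top h1
  have h2' : (s.toJordanDecomposition.negPart.rnDeriv μ x).toReal ≤ 1 := by
    simpa using ENNReal.toReal_mono ENNReal.one_ne_top h2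
  have h3 := ENNReal.toReal_nonneg (a := s.toJordanDecomposition.posPart.rnDeriv μ x)
  have h4 := ENNReal.toReal_nonneg (a := s.toJordanDecomposition.negPart.rnDeriv μ x)
  rw [SignedMeasure.rnDeriv, abs_le]
  constructor <;> linarith

/-! ### Densities of the matrix measures -/

namespace OrderZeroMatrix

variable {a b : EReal} {n : ℕ} (q : OrderZeroMatrix a b n) (hq : q.Regular)

theorem integrable_density (i j : Fin n) :
    Integrable (fun x => q.density hq x i j) (q.base hq) :=
  (q.entry hq i j).integrable_rnDeriv (q.base hq)

theorem totalVariation_le_base (i j : Fin n) :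
    (ComplexMeasure.re (q.entry hq i j)).totalVariation +
      (ComplexMeasure.im (q.entry hq i j)).totalVariation ≤ q.base hq := by
  refine Measure.le_iff'.2 fun S => ?_
  simp only [base, Measure.finsetSum_apply, Measure.add_apply]
  refine le_trans ?_ (Finset.single_le_sum
    (f := fun i' => ∑ j', ((ComplexMeasure.re (q.entry hq i' j')).totalVariation S +
      (ComplexMeasure.im (q.entry hq i' j')).totalVariation S))
    (fun _ _ => zero_le) (Finset.mem_univ i))
  exact Finset.single_le_sum
    (f := fun j' => (ComplexMeasure.re (q.entry hq i j')).totalVariation S +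
      (ComplexMeasure.im (q.entry hq i j')).totalVariation S)
    (fun _ _ => zero_le) (Finset.mem_univ j)

theorem norm_density_le : ∀ᵐ x ∂(q.base hq), ∀ i j, ‖q.density hq x i j‖ ≤ 2 := by
  refine ae_all_iff.2 fun i => ae_all_iff.2 fun j => ?_
  have h := q.totalVariation_le_base hq i j
  filter_upwards [abs_rnDeriv_le_one ((Measure.le_add_right le_rfl).trans h),
    abs_rnDeriv_le_one ((Measure.le_add_left le_rfl).trans h)] with x h1 h2
  refine (Complex.norm_le_abs_re_add_abs_im _).trans ?_
  have e1 : (q.density hq x i j).re =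
    (ComplexMeasure.re (q.entry hq i j)).rnDeriv (q.base hq) x := rfl
  have e2 : (q.density hq x i j).im =
    (ComplexMeasure.im (q.entry hq i j)).rnDeriv (q.base hq) x := rfl
  rw [e1, e2]
  linarith

/-- The density takes values in every closed cone which contains the increments of the
anti-derivative. -/
theorem density_mem_of_isClosed {P : Set (Matrix (Fin n) (Fin n) ℂ)} (hP : IsClosed P)
    (hcone : ∀ M ∈ P, ∀ r : ℝ, 0 ≤ r → r • M ∈ P)
    (hq' : ∀ s ∈ interval a b, ∀ t ∈ interval a b, s ≤ t → q.prim t - q.prim s ∈ P) :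
    ∀ᵐ x ∂((q.base hq).restrict (interval a b)), q.density hq x ∈ P := by
  have hint := q.integrable_density hq
  have hIcc : ∀ s ∈ interval a b, ∀ t ∈ interval a b, s ≤ t →
      (Matrix.of fun i j => ∫ y in Icc s t, q.density hq y i j ∂(q.base hq)) ∈ P := by
    intro s hs t ht hst
    have hlim : Tendsto (fun z => Matrix.of fun i j =>
        ∫ y in Ico s z, q.density hq y i j ∂(q.base hq)) (𝓝[>] t)
        (𝓝 (Matrix.of fun i j => ∫ y in Icc s t, q.density hq y i j ∂(q.base hq))) :=
      tendsto_pi_nhds.2 fun i => tendsto_pi_nhds.2 fun j =>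
        tendsto_setIntegral_Ico_nhdsGT (hint i j) s t
    refine hP.mem_of_tendsto hlim ?_
    obtain ⟨t', ht', htt'⟩ := exists_gt_mem_interval ht
    filter_upwards [Ioo_mem_nhdsGT htt'] with z hz
    have hzI := (interval_ordConnected a b).out ht ht' ⟨hz.1.le, hz.2.le⟩
    have hsz := hst.trans hz.1.le
    convert hq' s hs z hzI hsz using 1
    ext i j
    exact q.density_Ico hq i j hs hzI hsz
  -- Besicovitch differentiation: the density is a.e. the limit of averages over closed balls `[x -
  -- r, x + r]`. This is why masses of closed intervals were needed. Each average is a nonnegative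
  -- multiple of such a mass, hence in the cone.
  have hav : ∀ᵐ x ∂(q.base hq), ∀ i j, Tendsto
      (fun r => ⨍ y in Metric.closedBall x r, q.density hq y i j ∂(q.base hq)) (𝓝[>] 0)
      (𝓝 (q.density hq x i j)) := by
    refine ae_all_iff.2 fun i => ae_all_iff.2 fun j => ?_
    filter_upwards [(Besicovitch.vitaliFamily (q.base hq)).ae_tendsto_average
      (hint i j).locallyIntegrable] with x hx
    exact hx.comp (Besicovitch.tendsto_filterAt (q.base hq) x)
  rw [ae_restrict_iff' (isOpen_interval a b).measurableSet]
  filter_upwards [hav] with x hx hxI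
  have hlim : Tendsto (fun r => Matrix.of fun i j =>
      ⨍ y in Metric.closedBall x r, q.density hq y i j ∂(q.base hq)) (𝓝[>] 0)
      (𝓝 (q.density hq x)) :=
    tendsto_pi_nhds.2 fun i => tendsto_pi_nhds.2 fun j => hx i j
  refine hP.mem_of_tendsto hlim ?_
  obtain ⟨ε, hε, hεI⟩ := Metric.isOpen_iff.1 (isOpen_interval a b) x hxI
  filter_upwards [Ioo_mem_nhdsGT hε] with r hr
  have hmem : ∀ y ∈ Icc (x - r) (x + r), y ∈ interval a b := by
    intro y hy
    apply hεI
    rw [← Real.closedBall_eq_Icc] at hy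
    exact Metric.closedBall_subset_ball hr.2 hy
  have hr0 := hr.1
  have h1 := hcone _ (hIcc (x - r) (hmem _ ⟨le_rfl, by linarith⟩) (x + r)
    (hmem _ ⟨by linarith, le_rfl⟩) (by linarith))
    ((q.base hq).real (Icc (x - r) (x + r)))⁻¹ (inv_nonneg.2 measureReal_nonneg)
  convert h1 using 1
  ext i j
  simp only [Matrix.of_apply, Matrix.smul_apply, setAverage_eq, Real.closedBall_eq_Icc]

/-- The density of `q` with respect to a measure `μ` which dominates `q.base` on `(a, b)`. -/
noncomputable def densityWrt (μ : Measure ℝ) (x : ℝ) : Matrix (Fin n) (Fin n) ℂ :=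
  (((q.base hq).restrict (interval a b)).rnDeriv μ x).toReal • q.density hq x

variable {μ : Measure ℝ} [IsFiniteMeasure μ]
  (hle : (q.base hq).restrict (interval a b) ≤ μ)

include hle

/-- `μ` may charge sets null for the base measure, but there the Radon–Nikodym factor, and with it
`densityWrt`, vanishes a.e. -/
theorem ae_imp_of_ae_base {p : ℝ → Prop} (h : ∀ᵐ x ∂((q.base hq).restrict (interval a b)), p x) :
    ∀ᵐ x ∂μ, ((q.base hq).restrict (interval a b)).rnDeriv μ x ≠ 0 → p x := by
  rw [← Measure.withDensity_rnDeriv_eq _ μ hle.absolutelyContinuous] at h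
  exact (ae_withDensity_iff (Measure.measurable_rnDeriv _ _)).1 h

theorem densityWrt_mem {P : Set (Matrix (Fin n) (Fin n) ℂ)} (hP : IsClosed P) (h0 : 0 ∈ P)
    (hcone : ∀ M ∈ P, ∀ r : ℝ, 0 ≤ r → r • M ∈ P)
    (hq' : ∀ s ∈ interval a b, ∀ t ∈ interval a b, s ≤ t → q.prim t - q.prim s ∈ P) :
    ∀ᵐ x ∂μ, q.densityWrt hq μ x ∈ P := by
  filter_upwards [q.ae_imp_of_ae_base hq hle (q.density_mem_of_isClosed hq hP hcone hq')] with x hx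
  rw [densityWrt]
  by_cases h : ((q.base hq).restrict (interval a b)).rnDeriv μ x = 0
  · simpa [h] using h0
  · exact hcone _ (hx h) _ ENNReal.toReal_nonneg

theorem norm_densityWrt_le : ∀ᵐ x ∂μ, ∀ i j, ‖q.densityWrt hq μ x i j‖ ≤ 2 := by
  filter_upwards [q.ae_imp_of_ae_base hq hle (ae_restrict_of_ae (q.norm_density_le hq)),
    Measure.rnDeriv_le_one_of_le hle] with x hx h1 i j
  rw [densityWrt, Matrix.smul_apply, norm_smul, Real.norm_of_nonneg ENNReal.toReal_nonneg]
  by_cases h : ((q.base hq).restrict (interval a b)).rnDeriv μ x = 0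
  · simp [h]
  · have h1' : (((q.base hq).restrict (interval a b)).rnDeriv μ x).toReal ≤ 1 := by
      simpa using ENNReal.toReal_mono ENNReal.one_ne_top h1
    have := mul_le_mul h1' (hx h i j) (norm_nonneg _) zero_le_one
    linarith

/-- `f` is measurable only for the base measure; its values where the Radon–Nikodym factor vanishes
are irrelevant. -/
theorem aestronglyMeasurable_densityWrt_mulVec {f : ℝ → Fin n → ℂ}
    (hf : AEStronglyMeasurable f ((q.base hq).restrict (interval a b))) :
    AEStronglyMeasurable (fun x => q.densityWrt hq μ x *ᵥ f x) μ := by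
  have hmul : AEStronglyMeasurable (fun x => q.density hq x *ᵥ f x)
      ((q.base hq).restrict (interval a b)) := by
    refine AEMeasurable.aestronglyMeasurable (aemeasurable_pi_iff.2 fun i => ?_)
    change AEMeasurable (fun x => ∑ j, q.density hq x i j * f x j) _
    refine Finset.aemeasurable_fun_sum _ fun j _ => ?_
    exact (q.integrable_density hq i j).1.aemeasurable.restrict.mul
      (aemeasurable_pi_iff.1 hf.aemeasurable j)
  obtain ⟨g, hg, hfg⟩ := hmul
  refine AEStronglyMeasurable.congr
    (f := fun x => (((q.base hq).restrict (interval a b)).rnDeriv μ x).toReal • g x)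
    ((Measure.measurable_rnDeriv _ _).ennreal_toReal.aestronglyMeasurable.smul
      hg.aestronglyMeasurable) ?_
  filter_upwards [q.ae_imp_of_ae_base hq hle hfg] with x hx
  rw [densityWrt, Matrix.smul_mulVec]
  by_cases h : ((q.base hq).restrict (interval a b)).rnDeriv μ x = 0
  · simp [h]
  · rw [hx h]

theorem aemeasurable_densityWrt (i j : Fin n) :
    AEMeasurable (fun x => q.densityWrt hq μ x i j) μ := by
  have h := q.aestronglyMeasurable_densityWrt_mulVec hq hle (f := fun _ => Pi.single j 1)
    aestronglyMeasurable_const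
  have h2 := aemeasurable_pi_iff.1 h.aemeasurable i
  simpa using h2

theorem intervalProd_eq (g : ℝ → Fin n → ℂ) {s t : ℝ} (hs : s ∈ interval a b)
    (ht : t ∈ interval a b) :
    q.intervalProd hq g s t = ∫ x in Ico s t, q.densityWrt hq μ x *ᵥ g x ∂μ := by
  simp only [densityWrt, Matrix.smul_mulVec]
  rw [setIntegral_rnDeriv_smul hle.absolutelyContinuous measurableSet_Ico,
    Measure.restrict_restrict measurableSet_Ico, inter_eq_left.2]
  · rfl
  · exact fun x hx => (interval_ordConnected a b).out hs ht ⟨hx.1, hx.2.le⟩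

theorem pairing_eq (g h : ℝ → Fin n → ℂ) :
    q.pairing hq g h = ∫ x, star (g x) ⬝ᵥ (q.densityWrt hq μ x *ᵥ h x) ∂μ := by
  simp only [densityWrt, Matrix.smul_mulVec, dotProduct_smul]
  rw [integral_rnDeriv_smul hle.absolutelyContinuous]
  rfl

/-- Positivity and the entry bound 2 give `‖W f‖² ≤ 2 f* W f` pointwise. `f` itself need not lie in
`L²(μ)`. -/
theorem memLp_densityWrt_mulVec (hpos : q.IsNonneg) {f : ℝ → Fin n → ℂ} (hf : q.MemL2 hq f) :
    MemLp (fun x => q.densityWrt hq μ x *ᵥ f x) 2 μ := by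
  have hm := q.aestronglyMeasurable_densityWrt_mulVec hq hle hf.1
  rw [memLp_two_iff_integrable_sq_norm hm]
  have hint : Integrable (fun x => star (f x) ⬝ᵥ (q.densityWrt hq μ x *ᵥ f x)) μ := by
    simp only [densityWrt, Matrix.smul_mulVec, dotProduct_smul]
    exact (integrable_rnDeriv_smul_iff hle.absolutelyContinuous).2 hf.2
  refine (hint.re.const_mul 2).mono (hm.norm.pow 2) ?_
  filter_upwards [q.norm_densityWrt_le hq hle, q.densityWrt_mem hq hle
    (isClosed_setOf_posSemidef n) Matrix.PosSemidef.zero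
    (fun M hM r hr => hM.smul hr) hpos] with x h1 h2
  have h3 := norm_mulVec_sq_le h2 h1 (f x)
  rw [Real.norm_of_nonneg (by positivity)]
  exact h3.trans (le_abs_self _)

end OrderZeroMatrix

/-! ### Transfer from Hilbert space to `ℂⁿ` with matrices -/

section MatrixForm

variable {n : ℕ} {μ : Measure ℝ}

theorem norm_mulVec_le {M : Matrix (Fin n) (Fin n) ℂ} {C : ℝ} (hM : ∀ i j, ‖M i j‖ ≤ C)
    (v : Fin n → ℂ) : ‖M *ᵥ v‖ ≤ n * C * ‖v‖ := by
  rcases isEmpty_or_nonempty (Fin n) with hn | ⟨⟨i₀⟩⟩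
  · rw [Subsingleton.elim (M *ᵥ v) 0, Subsingleton.elim v 0]
    simp
  have hC : 0 ≤ C := (norm_nonneg _).trans (hM i₀ i₀)
  refine (pi_norm_le_iff_of_nonneg (by positivity)).2 fun i => ?_
  calc ‖(M *ᵥ v) i‖ ≤ ∑ j, ‖M i j * v j‖ := by
        change ‖∑ j, M i j * v j‖ ≤ _
        exact norm_sum_le _ _
    _ ≤ ∑ _j : Fin n, C * ‖v‖ := Finset.sum_le_sum fun j _ => by
        rw [norm_mul]
        exact mul_le_mul (hM i j) (norm_le_pi_norm v j) (norm_nonneg _) hC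
    _ = n * C * ‖v‖ := by simp [mul_assoc]

theorem exists_forall_norm_apply_le (M : Matrix (Fin n) (Fin n) ℂ) : ∃ C, ∀ i j, ‖M i j‖ ≤ C := by
  refine ⟨∑ i, ∑ j, ‖M i j‖, fun i j => ?_⟩
  exact (Finset.single_le_sum (f := fun j => ‖M i j‖) (fun _ _ => norm_nonneg _)
    (Finset.mem_univ j)).trans (Finset.single_le_sum (f := fun i => ∑ j, ‖M i j‖)
      (fun _ _ => Finset.sum_nonneg fun _ _ => norm_nonneg _) (Finset.mem_univ i))

theorem memLp_mulVec {M : ℝ → Matrix (Fin n) (Fin n) ℂ}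
    (hM : ∀ i j, AEMeasurable (fun x => M x i j) μ) {C : ℝ}
    (hC : ∀ᵐ x ∂μ, ∀ i j, ‖M x i j‖ ≤ C) {p : ENNReal} {g : ℝ → Fin n → ℂ} (hg : MemLp g p μ) :
    MemLp (fun x => M x *ᵥ g x) p μ := by
  refine hg.of_le_mul (c := n * C)
    (AEMeasurable.aestronglyMeasurable (aemeasurable_pi_iff.2 fun i => ?_)) ?_
  · change AEMeasurable (fun x => ∑ j, M x i j * g x j) _
    exact Finset.aemeasurable_fun_sum _ fun j _ =>
      (hM i j).mul (aemeasurable_pi_iff.1 hg.1.aemeasurable j)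
  · filter_upwards [hC] with x hx
    exact norm_mulVec_le hx _

theorem memLp_const_mulVec (M : Matrix (Fin n) (Fin n) ℂ) {p : ENNReal} {g : ℝ → Fin n → ℂ}
    (hg : MemLp g p μ) : MemLp (fun x => M *ᵥ g x) p μ := by
  obtain ⟨C, hC⟩ := exists_forall_norm_apply_le M
  exact memLp_mulVec (M := fun _ => M) (fun _ _ => aemeasurable_const) (Eventually.of_forall fun _ => hC) hg

theorem integral_const_mulVec (M : Matrix (Fin n) (Fin n) ℂ) {g : ℝ → Fin n → ℂ}
    (hg : Integrable g μ) : ∫ x, M *ᵥ g x ∂μ = M *ᵥ ∫ x, g x ∂μ :=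
  (Matrix.mulVecLin M).toContinuousLinearMap.integral_comp_comm hg

/-- Reduces measurability and boundedness of an operator-valued function to those of its matrix
entries. -/
theorem toEuclideanCLM_eq_sum (M : Matrix (Fin n) (Fin n) ℂ) :
    Matrix.toEuclideanCLM (n := Fin n) (𝕜 := ℂ) M =
      ∑ i, ∑ j, M i j • Matrix.toEuclideanCLM (n := Fin n) (𝕜 := ℂ) (Matrix.single i j 1) := by
  conv_lhs => rw [Matrix.matrix_eq_sum_single M]
  rw [map_sum]
  refine Finset.sum_congr rfl fun i _ => ?_
  rw [map_sum]
  refine Finset.sum_congr rfl fun j _ => ?_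
  rw [← map_smul, Matrix.smul_single, smul_eq_mul, mul_one]

/-- A Hilbert space model of `ℂⁿ` with the standard inner product, with the action of matrices. -/
theorem exists_euclidean_model (n : ℕ) :
    ∃ e : (Fin n → ℂ) ≃L[ℂ] EuclideanSpace ℂ (Fin n),
      (∀ v u, inner ℂ (e v) (e u) = star v ⬝ᵥ u) ∧
      ∃ Φ : Matrix (Fin n) (Fin n) ℂ → EuclideanSpace ℂ (Fin n) →L[ℂ] EuclideanSpace ℂ (Fin n),
        (∀ M, Φ M = ∑ i, ∑ j, M i j • Φ (Matrix.single i j 1)) ∧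
        (∀ M N, M * N = 1 → ∀ x, Φ M (Φ N x) = x) ∧ (∀ M, (Φ M).adjoint = Φ Mᴴ) ∧
        (∀ M, Φ (-M) = -Φ M) ∧ ∀ M v, Φ M (e v) = e (M *ᵥ v) := by
  refine ⟨(EuclideanSpace.equiv (Fin n) ℂ).symm, fun v u => ?_,
    Matrix.toEuclideanCLM (n := Fin n) (𝕜 := ℂ), toEuclideanCLM_eq_sum, fun M N h x => ?_,
    fun M => (map_star _ M).symm, fun M => map_neg _ M, fun M v => rfl⟩
  · rw [EuclideanSpace.inner_eq_star_dotProduct, dotProduct_comm]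
    rfl
  · rw [← mul_apply_eq_comp, ← map_mul, h, map_one]
    rfl

/-- The matrix form of `exists_integral_eq_zero_iff`. -/
theorem exists_integral_eq_zero_iff_matrix [IsFiniteMeasure μ] {J : Matrix (Fin n) (Fin n) ℂ}
    (hJ : IsUnit J) (hskew : Jᴴ = -J) {A : ℝ → Matrix (Fin n) (Fin n) ℂ}
    (hA : ∀ i j, AEMeasurable (fun x => A x i j) μ) {C : ℝ}
    (hC : ∀ᵐ x ∂μ, ∀ i j, ‖A x i j‖ ≤ C) {F : ℝ → Fin n → ℂ} (hF : MemLp F 2 μ) :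
    (∃ g : ℝ → Fin n → ℂ, MemLp g 2 μ ∧ ∫ x, g x ∂μ = 0 ∧
        ∀ᵐ x ∂μ, J *ᵥ g x + A x *ᵥ balancedPrim μ g x = F x) ↔
      ∀ (c : Fin n → ℂ) (h : ℝ → Fin n → ℂ), MemLp h 2 μ →
        (∀ᵐ x ∂μ, J *ᵥ h x + (A x)ᴴ *ᵥ (c + balancedPrim μ h x) = 0) →
        ∫ x, star (c + balancedPrim μ h x) ⬝ᵥ F x ∂μ = 0 := by
  -- `Fin n → ℂ` carries the sup norm, so the Fredholm alternative is applied in the Euclidean model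
  -- and carried back along `e`.
  obtain ⟨e, hinner, Φ, hsum, hmul, hstar, hneg, hΦe⟩ := exists_euclidean_model n
  have hdet := (Matrix.isUnit_iff_isUnit_det J).1 hJ
  have hprim : ∀ g : ℝ → Fin n → ℂ, MemLp g 2 μ → ∀ x,
      balancedPrim μ (fun y => e (g y)) x = e (balancedPrim μ g x) := fun g hg x =>
    balancedPrim_comp (e.toContinuousLinearMap.restrictScalars ℝ)
      (hg.integrable (by norm_num)) x
  have hLp : ∀ g : ℝ → Fin n → ℂ, MemLp g 2 μ → MemLp (fun y => e (g y)) 2 μ := fun g hg =>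
    e.toContinuousLinearMap.comp_memLp' hg
  have hLp' : ∀ g : ℝ → EuclideanSpace ℂ (Fin n), MemLp g 2 μ →
      MemLp (fun y => e.symm (g y)) 2 μ := fun g hg =>
    e.symm.toContinuousLinearMap.comp_memLp' hg
  have key := exists_integral_eq_zero_iff (μ := μ) (Φ J) (Φ J⁻¹)
    (hmul _ _ (Matrix.nonsing_inv_mul J hdet)) (hmul _ _ (Matrix.mul_nonsing_inv J hdet))
    (fun x y => by
      rw [← ContinuousLinearMap.adjoint_inner_right, hstar, hskew, hneg, neg_apply, inner_neg_right])
    (A := fun x => Φ (A x)) (C := ∑ i, ∑ j, C * ‖Φ (Matrix.single i j 1)‖)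
    (by
      simp only [hsum (A _)]
      refine Finset.aestronglyMeasurable_fun_sum _ fun i _ =>
        Finset.aestronglyMeasurable_fun_sum _ fun j _ => ?_
      exact (hA i j).aestronglyMeasurable.smul_const _)
    (by
      filter_upwards [hC] with x hx
      rw [hsum]
      refine (norm_sum_le _ _).trans (Finset.sum_le_sum fun i _ =>
        (norm_sum_le _ _).trans (Finset.sum_le_sum fun j _ => ?_))
      rw [norm_smul]
      exact mul_le_mul_of_nonneg_right (hx i j) (norm_nonneg _))
    (hLp F hF)
  have hl : (∃ g : ℝ → Fin n → ℂ, MemLp g 2 μ ∧ ∫ x, g x ∂μ = 0 ∧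
      ∀ᵐ x ∂μ, J *ᵥ g x + A x *ᵥ balancedPrim μ g x = F x) ↔
      ∃ g : ℝ → EuclideanSpace ℂ (Fin n), MemLp g 2 μ ∧ ∫ x, g x ∂μ = 0 ∧
        ∀ᵐ x ∂μ, Φ J (g x) + Φ (A x) (balancedPrim μ g x) = e (F x) := by
    have aux : ∀ g : ℝ → Fin n → ℂ, MemLp g 2 μ → ((∫ x, g x ∂μ = 0 ∧
        ∀ᵐ x ∂μ, J *ᵥ g x + A x *ᵥ balancedPrim μ g x = F x) ↔ (∫ x, e (g x) ∂μ = 0 ∧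
        ∀ᵐ x ∂μ, Φ J (e (g x)) + Φ (A x) (balancedPrim μ (fun y => e (g y)) x) = e (F x))) := by
      intro g hg
      refine and_congr ?_ (eventually_congr (Eventually.of_forall fun x => ?_))
      · rw [ContinuousLinearEquiv.integral_comp_comm, EmbeddingLike.map_eq_zero_iff]
      · rw [hprim g hg, hΦe, hΦe, ← map_add, e.injective.eq_iff]
    constructor
    · rintro ⟨g, hg, h⟩
      exact ⟨fun x => e (g x), hLp g hg, (aux g hg).1 h⟩
    · rintro ⟨g, hg, h⟩
      exact ⟨fun x => e.symm (g x), hLp' g hg, (aux _ (hLp' g hg)).2 (by simpa using h)⟩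
  rw [hl, key]
  have aux : ∀ (c : Fin n → ℂ) (h : ℝ → Fin n → ℂ), MemLp h 2 μ →
      (((∀ᵐ x ∂μ, J *ᵥ h x + (A x)ᴴ *ᵥ (c + balancedPrim μ h x) = 0) →
        ∫ x, star (c + balancedPrim μ h x) ⬝ᵥ F x ∂μ = 0) ↔
      ((∀ᵐ x ∂μ, Φ J (e (h x)) +
          (Φ (A x)).adjoint (e c + balancedPrim μ (fun y => e (h y)) x) = 0) →
        ∫ x, inner ℂ (e c + balancedPrim μ (fun y => e (h y)) x) (e (F x)) ∂μ = 0)) := by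
    intro c h hh
    simp only [hprim h hh, ← map_add, hinner, hstar, hΦe, EmbeddingLike.map_eq_zero_iff]
  constructor
  · intro H c h hh
    exact (aux c h hh).2 (H (e c) (fun x => e (h x)) (hLp h hh))
  · intro H c h hh
    have := (aux (e.symm c) (fun x => e.symm (h x)) (hLp' h hh)).1 (H _ _ (hLp' h hh))
    simpa using this

end MatrixForm

/-! ### Solutions as balanced primitives -/

section Solutions

variable {a b : EReal} {n : ℕ} {J : Matrix (Fin n) (Fin n) ℂ} {q w : OrderZeroMatrix a b n}
  {hq : q.Regular} {hw : w.Regular} {μ : Measure ℝ} [IsFiniteMeasure μ]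

/-- The left limits of the primitive have increments `∫ g` over `[s, t)`, so integrating the
pointwise equation over `[s, t)` gives the equation of measures. -/
theorem isSolution_const_add_balancedPrim (hμ : ∀ᵐ y ∂μ, y ∈ interval a b)
    (hqμ : (q.base hq).restrict (interval a b) ≤ μ)
    (hwμ : (w.base hw).restrict (interval a b) ≤ μ) {lam : ℂ} {f : ℝ → Fin n → ℂ}
    {c : Fin n → ℂ} {g : ℝ → Fin n → ℂ} (hg : Integrable g μ)
    (h : ∀ᵐ x ∂μ, J *ᵥ g x + (q.densityWrt hq μ x - lam • w.densityWrt hw μ x) *ᵥ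
      (c + balancedPrim μ g x) = w.densityWrt hw μ x *ᵥ f x) :
    IsSolution J q w hq hw lam f (fun x => c + balancedPrim μ g x) := by
  have hbv : IsBalancedBV a b (fun x => c + balancedPrim μ g x) :=
    isBalancedBV_const_add_balancedPrim hg c
  refine ⟨hbv, fun s hs t ht hst => ?_⟩
  have hu1 : MemLp (fun x => c + balancedPrim μ g x) 1 μ :=
    MemLp.of_bound (aestronglyMeasurable_of_locallyBV hμ hbv.1) (‖c‖ + ∫ y, ‖g y‖ ∂μ)
      (Eventually.of_forall fun x => (norm_add_le _ _).trans
        (add_le_add le_rfl (norm_balancedPrim_le hg x)))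
  have hQ := memLp_one_iff_integrable.1 (memLp_mulVec (q.aemeasurable_densityWrt hq hqμ)
    (q.norm_densityWrt_le hq hqμ) hu1)
  have hW := memLp_one_iff_integrable.1 (memLp_mulVec (w.aemeasurable_densityWrt hw hwμ)
    (w.norm_densityWrt_le hw hwμ) hu1)
  have hWl : Integrable (fun x => lam • w.densityWrt hw μ x *ᵥ (c + balancedPrim μ g x)) μ :=
    hW.smul lam
  have hQW : Integrable (fun x => q.densityWrt hq μ x *ᵥ (c + balancedPrim μ g x) -
      lam • w.densityWrt hw μ x *ᵥ (c + balancedPrim μ g x)) μ := hQ.sub hWl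
  have hJg := memLp_one_iff_integrable.1 (memLp_const_mulVec J (memLp_one_iff_integrable.2 hg))
  rw [leftLim_const_add_balancedPrim hg, leftLim_const_add_balancedPrim hg, add_sub_add_left_eq_sub,
    setIntegral_Iio_sub hg hst, ← integral_const_mulVec J hg.integrableOn,
    q.intervalProd_eq hq hqμ _ hs ht, w.intervalProd_eq hw hwμ _ hs ht,
    w.intervalProd_eq hw hwμ _ hs ht, ← integral_smul,
    ← integral_sub hQ.integrableOn hWl.integrableOn,
    ← integral_add hJg.integrableOn hQW.integrableOn]
  refine integral_congr_ae (ae_restrict_of_ae ?_)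
  filter_upwards [h] with x hx
  rw [← hx, Matrix.sub_mulVec, Matrix.smul_mulVec]

/-- Solving for the increments of `u` with `J⁻¹` gives a Gronwall condition, so `u` is bounded. Then
`g = J⁻¹ (W f - A u)` is in `L²(μ)` and `u` is a primitive of it. -/
theorem IsSolution.exists_eq_const_add_balancedPrim (hab : a < b) (hJ : IsUnit J)
    (hμ : ∀ᵐ y ∂μ, y ∈ interval a b)
    (hqμ : (q.base hq).restrict (interval a b) ≤ μ)
    (hwμ : (w.base hw).restrict (interval a b) ≤ μ) {lam : ℂ} {f u : ℝ → Fin n → ℂ}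
    (hF : MemLp (fun x => w.densityWrt hw μ x *ᵥ f x) 2 μ)
    (hu : IsSolution J q w hq hw lam f u) :
    ∃ c g, MemLp g 2 μ ∧ (∀ x ∈ interval a b, u x = c + balancedPrim μ g x) ∧
      ∀ᵐ x ∂μ, J *ᵥ g x + (q.densityWrt hq μ x - lam • w.densityWrt hw μ x) *ᵥ
        (c + balancedPrim μ g x) = w.densityWrt hw μ x *ᵥ f x := by
  have hdet := (Matrix.isUnit_iff_isUnit_det J).1 hJ
  obtain ⟨hbv, heq⟩ := hu
  have hum := aestronglyMeasurable_of_locallyBV hμ hbv.1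
  have hFi := integrable_of_memLp_two hF
  obtain ⟨Cj, hCj⟩ := exists_forall_norm_apply_le J⁻¹
  -- The maximum ensures `0 ≤ K` even if `n = 0`, when `Cj` may be negative.
  set K := n * max Cj 0 with hK
  have hK0 : 0 ≤ K := by positivity
  have hKle : ∀ v, ‖J⁻¹ *ᵥ v‖ ≤ K * ‖v‖ := fun v => norm_mulVec_le
    (fun i j => (hCj i j).trans (le_max_left _ _)) v
  have hinc : ∀ s ∈ interval a b, ∀ t ∈ interval a b, s ≤ t →
      Function.leftLim u t - Function.leftLim u s = J⁻¹ *ᵥ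
        (∫ x in Ico s t, w.densityWrt hw μ x *ᵥ f x ∂μ -
          (∫ x in Ico s t, q.densityWrt hq μ x *ᵥ u x ∂μ -
            lam • ∫ x in Ico s t, w.densityWrt hw μ x *ᵥ u x ∂μ)) := by
    intro s hs t ht hst
    rw [← w.intervalProd_eq hw hwμ _ hs ht, ← q.intervalProd_eq hq hqμ _ hs ht,
      ← w.intervalProd_eq hw hwμ _ hs ht, ← heq s hs t ht hst, add_sub_cancel_right,
      Matrix.mulVec_mulVec, Matrix.nonsing_inv_mul J hdet, Matrix.one_mulVec]
  obtain ⟨B, hB⟩ : ∃ B, ∀ x ∈ interval a b, ‖u x‖ ≤ B := by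
    -- `A` collects the inhomogeneity; in `κ` each `n * 2` bounds a matrix whose entries have norm
    -- at most 2.
    refine exists_norm_le_of_gronwall hab hμ hbv (A := K * ∫ x, ‖w.densityWrt hw μ x *ᵥ f x‖ ∂μ)
      (κ := K * (n * 2 + ‖lam‖ * (n * 2))) (by positivity) ?_
    intro s hs t ht hst M hM hM0
    have hbound : ∀ D : ℝ → Matrix (Fin n) (Fin n) ℂ, (∀ᵐ x ∂μ, ∀ i j, ‖D x i j‖ ≤ 2) →
        ‖∫ x in Ico s t, D x *ᵥ u x ∂μ‖ ≤ n * 2 * M * μ.real (Ico s t) := by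
      intro D hD
      refine norm_setIntegral_le_of_norm_le_const_ae (measure_lt_top _ _) ?_
      rw [ae_restrict_iff' measurableSet_Ico]
      filter_upwards [hD] with x hx hxs
      exact (norm_mulVec_le hx _).trans (by gcongr; exact hM x hxs)
    have hbF : ‖∫ x in Ico s t, w.densityWrt hw μ x *ᵥ f x ∂μ‖ ≤
        ∫ x, ‖w.densityWrt hw μ x *ᵥ f x‖ ∂μ :=
      (norm_integral_le_integral_norm _).trans
        (setIntegral_le_integral hFi.norm (Eventually.of_forall fun x => norm_nonneg _))
    rw [hinc s hs t ht hst]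
    refine (hKle _).trans ?_
    have h1 := hbound _ (q.norm_densityWrt_le hq hqμ)
    have h2 := hbound _ (w.norm_densityWrt_le hw hwμ)
    have h3 := mul_le_mul_of_nonneg_left h2 (norm_nonneg lam)
    rw [← norm_smul] at h3
    calc _ ≤ K * (∫ x, ‖w.densityWrt hw μ x *ᵥ f x‖ ∂μ + (n * 2 * M * μ.real (Ico s t) +
          ‖lam‖ * (n * 2 * M * μ.real (Ico s t)))) := by
          gcongr
          exact (norm_sub_le _ _).trans
            (add_le_add hbF ((norm_sub_le _ _).trans (add_le_add h1 h3)))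
      _ = _ := by ring
  have hu2 : MemLp u 2 μ := MemLp.of_bound hum B (hμ.mono hB)
  have hQ := memLp_mulVec (q.aemeasurable_densityWrt hq hqμ) (q.norm_densityWrt_le hq hqμ) hu2
  have hW := memLp_mulVec (w.aemeasurable_densityWrt hw hwμ) (w.norm_densityWrt_le hw hwμ) hu2
  have hWl : MemLp (fun x => lam • w.densityWrt hw μ x *ᵥ u x) 2 μ := hW.const_smul lam
  have hQW : MemLp (fun x => q.densityWrt hq μ x *ᵥ u x - lam • w.densityWrt hw μ x *ᵥ u x) 2 μ :=
    hQ.sub hWl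
  have hrhs : MemLp (fun x => w.densityWrt hw μ x *ᵥ f x - (q.densityWrt hq μ x *ᵥ u x -
    lam • w.densityWrt hw μ x *ᵥ u x)) 2 μ := hF.sub hQW
  set g : ℝ → Fin n → ℂ := fun x => J⁻¹ *ᵥ (w.densityWrt hw μ x *ᵥ f x -
    (q.densityWrt hq μ x *ᵥ u x - lam • w.densityWrt hw μ x *ᵥ u x)) with hg
  have hgL : MemLp g 2 μ := memLp_const_mulVec J⁻¹ hrhs
  obtain ⟨c, hc⟩ := eq_const_add_balancedPrim hab hbv (integrable_of_memLp_two hgL)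
    (fun s hs t ht hst => by
      rw [hinc s hs t ht hst, ← integral_smul,
        ← integral_sub (integrable_of_memLp_two hQ).integrableOn
          (integrable_of_memLp_two hWl).integrableOn,
        ← integral_sub hFi.integrableOn (integrable_of_memLp_two hQW).integrableOn,
        ← integral_const_mulVec _ (integrable_of_memLp_two hrhs).integrableOn])
  refine ⟨c, g, hgL, hc, ?_⟩
  filter_upwards [hμ] with x hx
  rw [← hc x hx, hg, Matrix.mulVec_mulVec, Matrix.mul_nonsing_inv J hdet, Matrix.one_mulVec,
    Matrix.sub_mulVec, Matrix.smul_mulVec, sub_add_cancel]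

end Solutions

end MeasureODE

/-! ### The solvability criterion -/

theorem mainTheorem5 {a b : EReal} (hab : a < b) {n : ℕ}
    (J : Matrix (Fin n) (Fin n) ℂ) (hJ : IsUnit J) (hJskew : Jᴴ = -J)
    (q w : MeasureODE.OrderZeroMatrix a b n) (hqherm : q.IsHermitian) (hwnonneg : w.IsNonneg)
    (hq : q.Regular) (hw : w.Regular)
    (lam : ℂ) (f : ℝ → Fin n → ℂ) (hf : w.MemL2 hw f) :
    (∃ u : ℝ → Fin n → ℂ, MeasureODE.IsSolution J q w hq hw lam f u ∧
        MeasureODE.VanishesAtLeft a u ∧ MeasureODE.VanishesAtRight b u) ↔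
      ∀ v : ℝ → Fin n → ℂ, MeasureODE.IsSolution J q w hq hw (starRingEnd ℂ lam) 0 v →
        w.pairing hw v f = 0 := by
  open MeasureODE in
  set μ : Measure ℝ := (q.base hq + w.base hw).restrict (interval a b) with hμdef
  have hμ : ∀ᵐ y ∂μ, y ∈ interval a b := ae_restrict_mem (isOpen_interval a b).measurableSet
  have hqμ : (q.base hq).restrict (interval a b) ≤ μ :=
    Measure.restrict_mono le_rfl (Measure.le_add_right le_rfl)
  have hwμ : (w.base hw).restrict (interval a b) ≤ μ :=
    Measure.restrict_mono le_rfl (Measure.le_add_left le_rfl)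
  have hF := w.memLp_densityWrt_mulVec hw hwμ hwnonneg hf
  have hQh : ∀ᵐ x ∂μ, (q.densityWrt hq μ x).IsHermitian :=
    q.densityWrt_mem hq hqμ (isClosed_setOf_isHermitian n) Matrix.isHermitian_zero
      (fun M hM r _ => by
        change (r • M)ᴴ = r • M
        rw [Matrix.conjTranspose_smul, star_trivial, hM]) hqherm
  have hWh : ∀ᵐ x ∂μ, (w.densityWrt hw μ x).IsHermitian :=
    w.densityWrt_mem hw hwμ (isClosed_setOf_isHermitian n) Matrix.isHermitian_zero
      (fun M hM r _ => by
        change (r • M)ᴴ = r • M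
        rw [Matrix.conjTranspose_smul, star_trivial, hM])
      (fun s hs t ht hst => (hwnonneg s hs t ht hst).1)
  -- Taking adjoints only conjugates `lam`, because `Q` and `W` are Hermitian a.e.; hence the
  -- conjugate parameter in the criterion.
  have hAh : ∀ᵐ x ∂μ, (q.densityWrt hq μ x - lam • w.densityWrt hw μ x)ᴴ =
      q.densityWrt hq μ x - (starRingEnd ℂ lam) • w.densityWrt hw μ x := by
    filter_upwards [hQh, hWh] with x h1 h2
    rw [Matrix.conjTranspose_sub, Matrix.conjTranspose_smul, h1, h2]
    rfl
  have hleft := leftEnd_neBot hab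
  have hright := rightEnd_neBot hab
  obtain ⟨r, hr1, hr2⟩ := EReal.lt_iff_exists_real_btwn.1 hab
  have hrI : r ∈ interval a b := ⟨hr1, hr2⟩
  have key := exists_integral_eq_zero_iff_matrix (μ := μ) hJ hJskew
    (A := fun x => q.densityWrt hq μ x - lam • w.densityWrt hw μ x) (C := 2 + ‖lam‖ * 2)
    (fun i j => (q.aemeasurable_densityWrt hq hqμ i j).sub
      ((w.aemeasurable_densityWrt hw hwμ i j).const_mul lam))
    (by
      filter_upwards [q.norm_densityWrt_le hq hqμ, w.norm_densityWrt_le hw hwμ] with x h1 h2 i j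
      refine (norm_sub_le _ _).trans (add_le_add (h1 i j) ?_)
      rw [Matrix.smul_apply, norm_smul]
      exact mul_le_mul_of_nonneg_left (h2 i j) (norm_nonneg _)) hF
  refine Iff.trans ⟨?_, ?_⟩ (key.trans ⟨?_, ?_⟩)
  · rintro ⟨u, hu, hua, hub⟩
    obtain ⟨c, g, hg, huc, hgF⟩ :=
      hu.exists_eq_const_add_balancedPrim hab hJ hμ hqμ hwμ hF
    have hgi := integrable_of_memLp_two hg
    -- The primitive tends to 0 at `a`, so `c` is the limit of `u` there. The limit at `b` is then
    -- `∫ g`.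
    have hc : c = 0 := by
      have h1 : Tendsto u (leftEnd a) (𝓝 (c + 0)) := by
        refine (tendsto_const_nhds.add (tendsto_balancedPrim_leftEnd hμ hgi)).congr' ?_
        filter_upwards [eventually_leftEnd_lt hrI] with x hx
        exact (huc x hx.1).symm
      simpa using tendsto_nhds_unique h1 hua
    subst hc
    refine ⟨g, hg, ?_, by simpa using hgF⟩
    have h1 : Tendsto u (rightEnd b) (𝓝 (0 + ∫ x, g x ∂μ)) := by
      refine (tendsto_const_nhds.add (tendsto_balancedPrim_rightEnd hμ hgi)).congr' ?_
      filter_upwards [eventually_rightEnd_gt hrI] with x hx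
      exact (huc x hx.1).symm
    simpa using tendsto_nhds_unique h1 hub
  · rintro ⟨g, hg, hg0, hgF⟩
    have hgi := integrable_of_memLp_two hg
    refine ⟨fun x => 0 + balancedPrim μ g x,
      isSolution_const_add_balancedPrim hμ hqμ hwμ hgi (by simpa using hgF), ?_, ?_⟩
    · have := tendsto_balancedPrim_leftEnd hμ hgi
      simpa [VanishesAtLeft] using this
    · have := tendsto_balancedPrim_rightEnd hμ hgi
      rw [hg0] at this
      simpa [VanishesAtRight] using this
  · intro H v hv
    obtain ⟨c, h, hh, hvc, hhv⟩ := hv.exists_eq_const_add_balancedPrim hab hJ hμ hqμ hwμ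
      (by simp)
    have h1 := H c h hh (by
      filter_upwards [hhv, hAh] with x hx hxA
      rw [hxA, hx]
      simp)
    rw [w.pairing_eq hw hwμ, ← h1]
    refine integral_congr_ae ?_
    filter_upwards [hμ] with x hx
    rw [hvc x hx]
  · intro H c h hh hch
    have h1 := H (fun x => c + balancedPrim μ h x)
      (isSolution_const_add_balancedPrim hμ hqμ hwμ (integrable_of_memLp_two hh) (by
        filter_upwards [hch, hAh] with x hx hxA
        rw [← hxA, hx]
        simp))
    rwa [w.pairing_eq hw hwμ] at h1
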